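/- Let $M$ be a smooth manifold of any dimension $n$ (including $n=2$), and let $(g,\nabla)$ be a statistical structure on $M$: $g$ is a smooth Riemannian metric and $\nabla$ is a smooth torsion-free affine connection such that the cubic form $$(\nabla g)(X,Y,Z)=X\,g(Y,Z)-g(\nabla_XY,Z)-g(Y,\nabla_XZ)$$ is symmetric in all its arguments. Let $\overline\nabla$ be the dual connection, defined by $$X\,g(Y,Z)=g(\nabla_XY,Z)+g(Y,\overline\nabla_XZ),$$ and assume that $(g,\nabla)$ is conjugate symmetric, that is, the curvature tensors of $\nabla$ and $\overline\nabla$ coincide: $R=\overline R$. Then $\nabla$ is projectively flat if and only if $\overline\nabla$ is projectively flat. Here a torsion-free connection $\nabla$ is called projectively flat if every point of $M$ has an open neighbourhood $U$ on which there are a smooth torsion-free connection $\nabla'$ with vanishing curvature and a smooth $1$-form $\rho$ such that $\nabla'_XY=\nabla_XY+\rho(X)Y+\rho(Y)X$ for all smooth vector fields $X,Y$ on $U$. -/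

import Mathlib

open Bundle Manifold Set VectorField
open scoped ContDiff Topology

namespace StatGeom

noncomputable section

variable
  {E : Type*} [NormedAddCommGroup E] [NormedSpace ℝ E]
  {H : Type*} [TopologicalSpace H] {I : ModelWithCorners ℝ E H}
  {M : Type*} [TopologicalSpace M] [ChartedSpace H M]

/-! Connections on the tangent bundle are Mathlib's covariant derivatives: `D Y x v` is `∇_v Y` at
the point `x`, so `∇_X Y` is the vector field `fun x ↦ D Y x (X x)`. -/

/-- The curvature `R(X, Y)Z = ∇_X ∇_Y Z - ∇_Y ∇_X Z - ∇_[X,Y] Z`, evaluated at `x`. -/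
def curvature
    (D : (Π x : M, TangentSpace I x) → (Π x : M, TangentSpace I x →L[ℝ] TangentSpace I x))
    (X Y Z : Π x : M, TangentSpace I x) (x : M) : TangentSpace I x :=
  D (fun y ↦ D Z y (Y y)) x (X x) - D (fun y ↦ D Z y (X y)) x (Y x)
    - D Z x (mlieBracket I X Y x)

/-- `D` is a smooth torsion-free connection with vanishing curvature on the set `U` (to be used
for open `U`); nothing is asked about `D` outside of `U`. -/
structure IsFlatOn [IsManifold I 1 M]
    (D : (Π x : M, TangentSpace I x) → (Π x : M, TangentSpace I x →L[ℝ] TangentSpace I x))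
    (U : Set M) : Prop where
  isCovariantDerivativeOn : IsCovariantDerivativeOn E D U
  smooth : ContMDiffCovariantDerivativeOn E ∞ D U
  torsion_eq_zero : ∀ X Y : (Π x : M, TangentSpace I x), CMDiff[U] ∞ (T% X) → CMDiff[U] ∞ (T% Y) →
    ∀ x ∈ U, D Y x (X x) - D X x (Y x) - mlieBracket I X Y x = 0
  curvature_eq_zero : ∀ X Y Z : (Π x : M, TangentSpace I x),
    CMDiff[U] ∞ (T% X) → CMDiff[U] ∞ (T% Y) → CMDiff[U] ∞ (T% Z) →
    ∀ x ∈ U, curvature D X Y Z x = 0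

/-- Projective equivalence on `U`: there is a smooth 1-form `ρ` on `U` such that
`D'_X Y = D_X Y + ρ(X) Y + ρ(Y) X` on `U`. -/
def ProjectivelyEquivalentOn [IsManifold I 1 M]
    (D D' : (Π x : M, TangentSpace I x) → (Π x : M, TangentSpace I x →L[ℝ] TangentSpace I x))
    (U : Set M) : Prop :=
  ∃ ρ : Π x : M, TangentSpace I x →L[ℝ] ℝ,
    ContMDiffOn I (I.prod 𝓘(ℝ, E →L[ℝ] ℝ)) ∞
      (fun x ↦ (TotalSpace.mk' (E →L[ℝ] ℝ) x (ρ x) :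
        TotalSpace (E →L[ℝ] ℝ) (fun x : M ↦ TangentSpace I x →L[ℝ] ℝ))) U ∧
    ∀ Y : (Π x : M, TangentSpace I x), CMDiff[U] ∞ (T% Y) → ∀ x ∈ U, ∀ v : TangentSpace I x,
      D' Y x v = D Y x v + ρ x v • Y x + ρ x (Y x) • v

/-- A connection is projectively flat if around each point it is projectively equivalent to a
flat (that is, torsion-free and of zero curvature) connection. -/
def IsProjectivelyFlat [IsManifold I 1 M]
    (cov : CovariantDerivative I E (TangentSpace I : M → Type _)) : Prop :=
  ∀ p : M, ∃ U : Set M, IsOpen U ∧ p ∈ U ∧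
    ∃ D : (Π x : M, TangentSpace I x) → (Π x : M, TangentSpace I x →L[ℝ] TangentSpace I x),
      IsFlatOn D U ∧ ProjectivelyEquivalentOn cov.toFun D U

section Riemannian

/-! The Riemannian metric `g` is `inner ℝ` on the tangent spaces. -/

variable [FiniteDimensional ℝ E]
  [RiemannianBundle (fun x : M ↦ TangentSpace I x)]

/-- The vector representing a linear form on a tangent space with respect to `g`. -/
def sharp (x : M) : (TangentSpace I x →L[ℝ] ℝ) →L[ℝ] TangentSpace I x :=
  haveI : FiniteDimensional ℝ (TangentSpace I x) := inferInstanceAs (FiniteDimensional ℝ E)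
  haveI : CompleteSpace (TangentSpace I x) := FiniteDimensional.complete ℝ _
  { toFun := fun α ↦ (InnerProductSpace.toDual ℝ (TangentSpace I x)).symm α
    map_add' := fun α β ↦ map_add _ α β
    map_smul' := fun c α ↦ by simp
    cont := (InnerProductSpace.toDual ℝ (TangentSpace I x)).symm.continuous }

lemma inner_sharp (x : M) (α : TangentSpace I x →L[ℝ] ℝ) (y : TangentSpace I x) :
    inner ℝ y (sharp x α) = α y := by
  have : FiniteDimensional ℝ (TangentSpace I x) := inferInstanceAs (FiniteDimensional ℝ E)
  have : CompleteSpace (TangentSpace I x) := FiniteDimensional.complete ℝ _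
  rw [real_inner_comm]
  exact InnerProductSpace.toDual_symm_apply (𝕜 := ℝ) (E := TangentSpace I x)

variable [IsManifold I ∞ M]
  [IsContMDiffRiemannianBundle I ∞ E (fun x : M ↦ TangentSpace I x)]

/-- The cubic form `(∇g)(X, Y, Z) = X g(Y, Z) - g(∇_X Y, Z) - g(Y, ∇_X Z)`. -/
def cubicForm (cov : CovariantDerivative I E (TangentSpace I : M → Type _)) (x : M)
    (u v w : TangentSpace I x) : ℝ :=
  cov.derivMetricTensor x v w u

/-- `(g, ∇)` is a statistical structure: `∇` is a smooth torsion-free connection and the cubic form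
`∇g` is symmetric in all its arguments. -/
structure IsStatistical (cov : CovariantDerivative I E (TangentSpace I : M → Type _)) :
    Prop where
  smooth : CovariantDerivative.ContMDiffCovariantDerivative cov ∞
  torsion_eq_zero : cov.torsion = 0
  cubicForm_symm : ∀ (x : M) (u v w : TangentSpace I x),
    cubicForm cov x u v w = cubicForm cov x v u w ∧ cubicForm cov x u v w = cubicForm cov x u w v

lemma cubicForm_add (cov : CovariantDerivative I E (TangentSpace I : M → Type _)) (x : M)
    (v z z' y : TangentSpace I x) :
    cubicForm cov x v (z + z') y = cubicForm cov x v z y + cubicForm cov x v z' y := by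
  have h := (cov.derivMetricTensor x).map_add z z'
  simp only [cubicForm, h]
  rfl

lemma cubicForm_smul (cov : CovariantDerivative I E (TangentSpace I : M → Type _)) (x : M)
    (c : ℝ) (v z y : TangentSpace I x) :
    cubicForm cov x v (c • z) y = c • cubicForm cov x v z y := by
  have h := (cov.derivMetricTensor x).map_smul c z
  simp only [cubicForm, h]
  rfl

/-- The linear form `y ↦ (∇g)(v, z, y)`. -/
def cubicFormLast (cov : CovariantDerivative I E (TangentSpace I : M → Type _)) (x : M)
    (v z : TangentSpace I x) : TangentSpace I x →L[ℝ] ℝ :=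
  haveI : FiniteDimensional ℝ (TangentSpace I x) := inferInstanceAs (FiniteDimensional ℝ E)
  LinearMap.toContinuousLinearMap
    { toFun := fun y ↦ cubicForm cov x v z y
      map_add' := fun y y' ↦ by simp [cubicForm]
      map_smul' := fun c y ↦ by simp [cubicForm] }

/-- The bilinear map `(z, v) ↦ ((∇g)(v, z, ·))♯`. -/
def dualCorrection (cov : CovariantDerivative I E (TangentSpace I : M → Type _)) (x : M) :
    TangentSpace I x →L[ℝ] TangentSpace I x →L[ℝ] TangentSpace I x :=
  haveI : FiniteDimensional ℝ (TangentSpace I x) := inferInstanceAs (FiniteDimensional ℝ E)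
  LinearMap.toContinuousLinearMap
    { toFun := fun z ↦ LinearMap.toContinuousLinearMap
        { toFun := fun v ↦ sharp x (cubicFormLast cov x v z)
          map_add' := fun v v' ↦ by
            rw [← map_add]; congr 1; ext y; simp [cubicFormLast, cubicForm]
          map_smul' := fun c v ↦ by
            rw [← map_smul]; congr 1; ext y; simp [cubicFormLast, cubicForm] }
      map_add' := fun z z' ↦ by
        ext v
        simp only [LinearMap.coe_toContinuousLinearMap', LinearMap.coe_mk, AddHom.coe_mk,
          _root_.add_apply]
        rw [← map_add]; congr 1; ext y; exact cubicForm_add cov x v z z' y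
      map_smul' := fun c z ↦ by
        ext v
        simp only [LinearMap.coe_toContinuousLinearMap', LinearMap.coe_mk, AddHom.coe_mk,
          _root_.smul_apply, RingHom.id_apply]
        rw [← map_smul]; congr 1; ext y; exact cubicForm_smul cov x c v z y }

/-- The dual connection of `∇` with respect to `g`, characterized by
`X g(Y, Z) = g(∇_X Y, Z) + g(Y, ∇̄_X Z)`, see `dual_spec`. It is built as
`∇̄_X Z = ∇_X Z + ((∇g)(X, Z, ·))♯`. -/
def dual (cov : CovariantDerivative I E (TangentSpace I : M → Type _)) :
    CovariantDerivative I E (TangentSpace I : M → Type _) :=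
  cov.addOneForm (dualCorrection cov)

theorem dual_spec (cov : CovariantDerivative I E (TangentSpace I : M → Type _))
    {Y Z : Π x : M, TangentSpace I x} {x : M}
    (hY : MDiffAt (T% Y) x) (hZ : MDiffAt (T% Z) x) (v : TangentSpace I x) :
    d% (fun y ↦ inner ℝ (Y y) (Z y)) x v =
      inner ℝ (cov Y x v) (Z x) + inner ℝ (Y x) (dual cov Z x v) := by
  have h1 : dual cov Z x v =
      cov Z x v + sharp x (cubicFormLast cov x v (Z x)) := rfl
  have h2 : cubicFormLast cov x v (Z x) (Y x) =
      d% (fun y ↦ inner ℝ (Z y) (Y y)) x v - inner ℝ (cov Z x v) (Y x)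
        - inner ℝ (Z x) (cov Y x v) := by
    have h3 := CovariantDerivative.derivMetricTensor_apply
      (V := fun x : M ↦ TangentSpace I x) cov (X := FiberBundle.extend E v) x hZ hY
    simpa [cubicFormLast, cubicForm] using h3
  have h4 : (fun y ↦ inner ℝ (Z y) (Y y)) = fun y ↦ inner ℝ (Y y) (Z y) := by
    funext y
    exact real_inner_comm _ _
  rw [h1, inner_add_right, inner_sharp, h2, h4,
    real_inner_comm (Y x) (cov Z x v), real_inner_comm (Z x) (cov Y x v)]
  ring

/-- A statistical structure is conjugate symmetric if `∇` and its dual connection have the same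
curvature tensor. -/
def IsConjugateSymmetric (cov : CovariantDerivative I E (TangentSpace I : M → Type _)) : Prop :=
  ∀ X Y Z : (Π x : M, TangentSpace I x), CMDiff ∞ (T% X) → CMDiff ∞ (T% Y) → CMDiff ∞ (T% Z) →
    ∀ x : M, curvature cov.toFun X Y Z x = curvature (dual cov).toFun X Y Z x

end Riemannian

end

end StatGeom

/-! The question is local, so it is settled in a chart, for the metric g and the Christoffel symbols
Γ, Γ' of ∇ and its dual. Symmetry of the second derivatives of g together with duality gives
g(R(u,v)a, b) + g(a, R̄(u,v)b) = 0, so conjugate symmetry makes R itself skew for g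
(`metric_curvature`). If a 1-form ρ changes ∇ into a flat connection, then R is an algebraic
expression in the Schouten form S = ∇ρ - ρ⊗ρ, and skewness forces S = k g at each point
(`eq_smul_of_skew`). Hence R(u,v)w = k (g(v,w)u - g(u,w)v).

In dimension at least 2 the factor k is locally constant (`exists_const_curvature`). A Schur
argument through the second Bianchi identity would lose dimension 2. Instead, ∇ρ = ρ⊗ρ + k g is
differentiated once more: the Ricci identity and the Codazzi equation for g leave dk(v) g(u,z) =
dk(u) g(v,z), and u = z orthogonal to v gives dk(v) = 0. The Codazzi equation rests on the symmetry
of Γ', that is, on the dual connection being torsion-free, which is what the symmetric cubic form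
provides.

The dual connection has the same curvature, hence the same constant k, and constant curvature
implies projective flatness (`exists_projectively_flat_of_const_curvature`): the linear system df =
α, ∇α = -k f g is integrable, again by Codazzi, so Frobenius (`exists_parallel_section`) yields a
solution with f ≠ 0, and ρ = -df/f has Schouten form k g, which cancels the curvature. In dimension
at most 1 every curvature vanishes. The remainder translates between connections on M and
Christoffel symbols; the coordinate criterion is `isProjectivelyFlat_iff`. -/

namespace StatGeom

/-! ### Frobenius theorem for linear total differential equations. -/

section Frobenius

set_option maxSynthPendingDepth 3

variable {E F : Type*} [NormedAddCommGroup E] [NormedSpace ℝ E]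
  [NormedAddCommGroup F] [NormedSpace ℝ F]

/-- A linear differential equation on the unit interval with small coefficients is solvable. -/
lemma exists_solution_linear_ode [CompleteSpace F] {B : ℝ → F →L[ℝ] F}
    (hB : ContinuousOn B (Icc 0 1)) (hb : ∀ t ∈ Icc (0 : ℝ) 1, ‖B t‖ ≤ 1 / 2) (s₀ : F) :
    ∃ u : ℝ → F, u 0 = s₀ ∧
      ∀ t ∈ Icc (0 : ℝ) 1, HasDerivWithinAt u (B t (u t)) (Icc 0 1) t := by
  -- On the ball of radius ‖s₀‖ + 1 about s₀ the field has norm at most (2‖s₀‖ + 1)/2, which is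
  -- below ‖s₀‖ + 1, so the solution cannot leave the ball within unit time.
  have hPL : IsPicardLindelof (fun t x ↦ B t x) (tmin := 0) (tmax := 1)
      (⟨0, by simp⟩ : Icc (0 : ℝ) 1) s₀ (‖s₀‖₊ + 1) 0 (‖s₀‖₊ + 1) (1 / 2) := by
    refine ⟨fun t ht ↦ ?_, fun x _ ↦ hB.clm_apply continuousOn_const, fun t ht x hx ↦ ?_, ?_⟩
    · refine ((B t).lipschitz.weaken ?_).lipschitzOnWith
      exact_mod_cast hb t ht
    · have h1 := (B t).le_of_opNorm_le (hb t ht) x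
      have h2 : ‖x‖ ≤ ‖s₀‖ + (‖s₀‖ + 1) := by
        have h3 : ‖x - s₀‖ ≤ ‖s₀‖ + 1 := by simpa [dist_eq_norm] using hx
        have h4 := norm_add_le (x - s₀) s₀
        rw [sub_add_cancel] at h4
        linarith
      push_cast
      linarith
    · simp
  simpa using hPL.exists_eq_forall_mem_Icc_hasDerivWithinAt₀

lemma hasDerivAt_comp_clm_apply {G : Type*} [NormedAddCommGroup G] [NormedSpace ℝ G]
    {f : E → F →L[ℝ] G} {c : ℝ → E} {h : E} {t : ℝ} (hf : DifferentiableAt ℝ f (c t))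
    (hc : HasDerivAt c h t) (w : F) :
    HasDerivAt (fun t ↦ f (c t) w) (fderiv ℝ f (c t) h w) t := by
  simpa using (hf.hasFDerivAt.comp_hasDerivAt t hc).clm_apply (hasDerivAt_const t w)

/-- First order Taylor estimate for a map with Lipschitz derivative. -/
lemma norm_sub_sub_fderiv_le {f : E → F} {s : Set E} (hs : Convex ℝ s)
    (hf : ∀ x ∈ s, DifferentiableAt ℝ f x) {K : NNReal} (hK : LipschitzOnWith K (fderiv ℝ f) s)
    {x y : E} (hx : x ∈ s) (hy : y ∈ s) :
    ‖f y - f x - fderiv ℝ f x (y - x)‖ ≤ K * ‖y - x‖ ^ 2 := by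
  have hsub : segment ℝ x y ⊆ s := hs.segment_subset hx hy
  have h := (convex_segment (𝕜 := ℝ) x y).norm_image_sub_le_of_norm_hasFDerivWithin_le'
    (f := f) (f' := fderiv ℝ f) (φ := fderiv ℝ f x) (C := K * ‖y - x‖)
    (fun z hz ↦ (hf z (hsub hz)).hasFDerivAt.hasFDerivWithinAt) (fun z hz ↦ ?_)
    (left_mem_segment ℝ x y) (right_mem_segment ℝ x y)
  · rwa [mul_assoc, ← pow_two] at h
  · refine (hK.norm_sub_le (hsub hz) hx).trans ?_
    gcongr
    obtain ⟨a, b, ha, hb, hab, rfl⟩ := hz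
    have : a • x + b • y - x = b • (y - x) := by
      rw [show a = 1 - b by linarith]; module
    rw [this, norm_smul, Real.norm_of_nonneg hb]
    exact mul_le_of_le_one_left (norm_nonneg _) (by linarith)

/-- Uniform bounds near a point for a smooth map. -/
lemma exists_ball_bounds {A : E → F} {V : Set E} (hV : IsOpen V) (hA : ContDiffOn ℝ ∞ A V)
    {q : E} (hq : q ∈ V) :
    ∃ r > 0, Metric.ball q r ⊆ V ∧ ∃ K : ℝ, 0 < K ∧ ∀ x ∈ Metric.ball q r, ‖A x‖ ≤ K ∧
      ∀ y ∈ Metric.ball q r, ‖A y - A x‖ ≤ K * ‖y - x‖ ∧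
        ‖A y - A x - fderiv ℝ A x (y - x)‖ ≤ K * ‖y - x‖ ^ 2 := by
  have hAq : ContDiffAt ℝ ∞ A q := hA.contDiffAt (hV.mem_nhds hq)
  obtain ⟨K₁, t₁, ht₁, h₁⟩ := (hAq.of_le (m := 1) (by exact_mod_cast le_top)).exists_lipschitzOnWith
  obtain ⟨K₂, t₂, ht₂, h₂⟩ := ((hAq.of_le (m := 2) ENat.LEInfty.out).fderiv_right
    (m := 1) (by norm_num)).exists_lipschitzOnWith
  have ht₃ : ∀ᶠ x in 𝓝 q, ‖A x‖ < ‖A q‖ + 1 :=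
    hAq.continuousAt.norm.eventually_lt_const (by linarith)
  obtain ⟨r, hr, hball⟩ := Metric.mem_nhds_iff.1
    (Filter.inter_mem (Filter.inter_mem ht₁ ht₂) (Filter.inter_mem ht₃ (hV.mem_nhds hq)))
  refine ⟨r, hr, fun x hx ↦ (hball hx).2.2, ‖A q‖ + 1 + K₁ + K₂, by positivity, fun x hx ↦
    ⟨?_, fun y hy ↦ ⟨?_, ?_⟩⟩⟩
  · have : ‖A x‖ < ‖A q‖ + 1 := (hball hx).2.1
    have := K₁.coe_nonneg
    have := K₂.coe_nonneg
    linarith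
  · refine (h₁.norm_sub_le (hball hy).1.1 (hball hx).1.1).trans ?_
    gcongr
    have := norm_nonneg (A q)
    have := K₂.coe_nonneg
    linarith
  · refine (norm_sub_sub_fderiv_le (convex_ball q r) (fun z hz ↦ ?_)
      (h₂.mono fun z hz ↦ (hball hz).1.2) hx hy).trans ?_
    · exact (hA.contDiffAt (hV.mem_nhds (hball hz).2.2)).differentiableAt (by simp)
    · gcongr
      have := norm_nonneg (A q)
      have := K₁.coe_nonneg
      linarith

/-- The difference of two solutions along nearby rays is given by the connection form to first
order, provided that the curvature vanishes. -/
lemma norm_sub_radial_solution_le {A : E → E →L[ℝ] F →L[ℝ] F} {q : E} {r K : ℝ} (hK : 0 < K)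
    (hA : ∀ x ∈ Metric.ball q r, DifferentiableAt ℝ A x)
    (hb : ∀ x ∈ Metric.ball q r, ‖A x‖ ≤ K ∧
      ∀ y ∈ Metric.ball q r, ‖A y - A x‖ ≤ K * ‖y - x‖ ∧
        ‖A y - A x - fderiv ℝ A x (y - x)‖ ≤ K * ‖y - x‖ ^ 2)
    (hflat : ∀ y ∈ Metric.ball q r, ∀ u v s, fderiv ℝ A y u v s + A y v (A y u s) =
      fderiv ℝ A y v u s + A y u (A y v s))
    {s₀ : F} {h w : E} {u₁ u₂ : ℝ → F} (h1 : q + h ∈ Metric.ball q r)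
    (h2 : q + (h + w) ∈ Metric.ball q r)
    (hu₁ : u₁ 0 = s₀ ∧ ∀ t ∈ Icc (0 : ℝ) 1,
      HasDerivWithinAt u₁ (A (q + t • h) h (u₁ t)) (Icc 0 1) t)
    (hu₂ : u₂ 0 = s₀ ∧ ∀ t ∈ Icc (0 : ℝ) 1,
      HasDerivWithinAt u₂ (A (q + t • (h + w)) (h + w) (u₂ t)) (Icc 0 1) t)
    {N : ℝ} (hN : ∀ t ∈ Icc (0 : ℝ) 1, ‖u₁ t‖ ≤ N) :
    ‖u₂ 1 - u₁ 1 - A (q + h) w (u₁ 1)‖ ≤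
      (K * r * N + K ^ 2 * r * N + K * N + K ^ 2 * N) * Real.exp (K * r) * ‖w‖ ^ 2 := by
  have hmem : ∀ {k : E}, q + k ∈ Metric.ball q r → ∀ t ∈ Icc (0 : ℝ) 1,
      q + t • k ∈ Metric.ball q r := by
    intro k hk t ht
    simp only [Metric.mem_ball, dist_self_add_left] at hk ⊢
    rw [norm_smul, Real.norm_of_nonneg ht.1]
    exact (mul_le_of_le_one_left (norm_nonneg _) ht.2).trans_lt hk
  have hh : ‖h‖ ≤ r := by simpa using (Metric.mem_ball.1 h1).le
  have hhw : ‖h + w‖ ≤ r := by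
    have := (Metric.mem_ball.1 h2).le
    rwa [dist_self_add_left] at this
  have hr : 0 ≤ r := (norm_nonneg _).trans hh
  have hN0 : 0 ≤ N := (norm_nonneg _).trans (hN 0 (by simp))
  set c : ℝ → E := fun t ↦ q + t • h with hc
  -- First-order guess for the solution along the neighbouring ray. Vanishing curvature trades the
  -- derivative of A along h for the one along w, so v satisfies the equation of that ray up to
  -- O(‖w‖²). Grönwall then compares it with `u₂`, which has the same initial value.
  set v : ℝ → F := fun t ↦ u₁ t + t • A (c t) w (u₁ t) with hv
  set v' : ℝ → F := fun t ↦ A (c t) w (u₁ t) + t • fderiv ℝ A (c t) w h (u₁ t) +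
    A (c t) h (v t) with hv'
  have hcd : ∀ t, HasDerivAt c h t := fun t ↦ by
    simpa [hc] using ((hasDerivAt_id t).smul_const h).const_add q
  have hvd : ∀ t ∈ Icc (0 : ℝ) 1, HasDerivWithinAt v (v' t) (Icc 0 1) t := by
    intro t ht
    have hct := hmem h1 t ht
    have hAd : HasDerivWithinAt (fun t ↦ A (c t) w) (fderiv ℝ A (c t) h w) (Icc 0 1) t := by
      exact (hasDerivAt_comp_clm_apply (hA _ hct) (hcd t) w).hasDerivWithinAt
    have h3 := (hu₁.2 t ht).add
      ((hasDerivWithinAt_id t (Icc 0 1)).smul (hAd.clm_apply (hu₁.2 t ht)))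
    refine h3.congr_deriv ?_
    have := hflat _ hct h w (u₁ t)
    have e : fderiv ℝ A (c t) h w (u₁ t) = fderiv ℝ A (c t) w h (u₁ t) +
        A (c t) h (A (c t) w (u₁ t)) - A (c t) w (A (c t) h (u₁ t)) :=
      eq_sub_of_add_eq this
    simp only [hv', hv, id, map_add, map_smul, e]
    change A (c t) h (u₁ t) + _ = _
    module
  have hbound : ∀ t ∈ Icc (0 : ℝ) 1, ‖v' t - A (q + t • (h + w)) (h + w) (v t)‖ ≤
      (K * r * N + K ^ 2 * r * N + K * N + K ^ 2 * N) * ‖w‖ ^ 2 := by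
    intro t ht
    have hct := hmem h1 t ht
    have hdt := hmem h2 t ht
    set d := q + t • (h + w) with hd
    have hdc : d - c t = t • w := by simp only [hd, hc]; module
    have hdn : ‖d - c t‖ ≤ ‖w‖ := by
      rw [hdc, norm_smul, Real.norm_of_nonneg ht.1]
      exact mul_le_of_le_one_left (norm_nonneg _) ht.2
    obtain ⟨b1, b2⟩ := hb _ hct
    obtain ⟨b3, b4⟩ := b2 _ hdt
    have b5 := (hb _ hdt).1
    have b6 := hN t ht
    set z := A (c t) w (u₁ t) with hz
    have hzn : ‖z‖ ≤ K * ‖w‖ * N := ContinuousLinearMap.le_of_opNorm₂_le_of_le _ b1 le_rfl b6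
    have htz : ‖t • z‖ ≤ K * ‖w‖ * N := by
      rw [norm_smul, Real.norm_of_nonneg ht.1]
      exact (mul_le_of_le_one_left (norm_nonneg _) ht.2).trans hzn
    -- A second-order Taylor remainder of A, plus three terms each containing two factors of size
    -- O(‖w‖).
    have e : v' t - A d (h + w) (v t) =
        -((A d - A (c t) - fderiv ℝ A (c t) (d - c t)) h (u₁ t) + (A d - A (c t)) h (t • z)
          + (A d - A (c t)) w (u₁ t) + A d w (t • z)) := by
      simp only [hv', hv, hdc, map_add, map_smul, _root_.sub_apply,
        _root_.add_apply, _root_.smul_apply, ← hz]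
      module
    rw [e, norm_neg]
    have b3' : ‖A d - A (c t)‖ ≤ K * ‖w‖ := b3.trans (by gcongr)
    have b4' : ‖A d - A (c t) - fderiv ℝ A (c t) (d - c t)‖ ≤ K * ‖w‖ ^ 2 :=
      b4.trans (by gcongr)
    have k1 := ContinuousLinearMap.le_of_opNorm₂_le_of_le _ b4' hh b6
    have k2 := ContinuousLinearMap.le_of_opNorm₂_le_of_le _ b3' hh htz
    have k3 := ContinuousLinearMap.le_of_opNorm₂_le_of_le _ b3' (le_refl ‖w‖) b6
    have k4 := ContinuousLinearMap.le_of_opNorm₂_le_of_le _ b5 (le_refl ‖w‖) htz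
    refine (norm_add_le_of_le (norm_add_le_of_le (norm_add_le_of_le k1 k2) k3) k4).trans
      (le_of_eq ?_)
    ring
  have hIci : ∀ {f : ℝ → F} {f' : F} {t : ℝ}, t ∈ Ico (0 : ℝ) 1 →
      HasDerivWithinAt f f' (Icc 0 1) t → HasDerivWithinAt f f' (Ici t) t := by
    intro f f' t ht hf
    refine (hf.mono (Icc_subset_Icc_left ht.1)).mono_of_mem_nhdsWithin
      (Icc_mem_nhdsGE ht.2)
  have key := dist_le_of_approx_trajectories_ODE_of_mem
    (v := fun t x ↦ A (q + t • (h + w)) (h + w) x) (s := fun _ ↦ univ)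
    (K := ⟨K * r, by positivity⟩) (a := 0) (b := 1) (f := u₂) (g := v) (δ := 0) (εf := 0)
    (f' := fun t ↦ A (q + t • (h + w)) (h + w) (u₂ t)) (g' := v')
    (εg := (K * r * N + K ^ 2 * r * N + K * N + K ^ 2 * N) * ‖w‖ ^ 2)
    (fun t ht ↦ ?_) (fun t ht ↦ (hu₂.2 t ht).continuousWithinAt)
    (fun t ht ↦ hIci ht (hu₂.2 t (Ico_subset_Icc_self ht))) (fun t _ ↦ by simp)
    (fun _ _ ↦ trivial) (fun t ht ↦ (hvd t ht).continuousWithinAt)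
    (fun t ht ↦ hIci ht (hvd t (Ico_subset_Icc_self ht)))
    (fun t ht ↦ by
      rw [dist_eq_norm]; exact hbound t (Ico_subset_Icc_self ht))
    (fun _ _ ↦ trivial) (by simp [hv, hu₁.1, hu₂.1]) 1 (by simp)
  · have e1 : u₂ 1 - u₁ 1 - A (q + h) w (u₁ 1) = u₂ 1 - v 1 := by
      simp [hv, hc, sub_sub]
    rw [e1, ← dist_eq_norm]
    refine key.trans ?_
    set D := (K * r * N + K ^ 2 * r * N + K * N + K ^ 2 * N) * ‖w‖ ^ 2 with hD
    have hD0 : 0 ≤ D := by positivity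
    have hmain : ∀ L : ℝ, 0 ≤ L → gronwallBound 0 L D 1 ≤ D * Real.exp L := by
      intro L hL
      rcases hL.eq_or_lt with rfl | hL
      · simp [gronwallBound_K0]
      · rw [gronwallBound_of_K_ne_0 hL.ne']
        have h5 : Real.exp L - 1 ≤ L * Real.exp L := by
          have := Real.add_one_le_exp (-L)
          rw [Real.exp_neg] at this
          have h6 := Real.exp_pos L
          have := mul_le_mul_of_nonneg_right this h6.le
          rw [inv_mul_cancel₀ h6.ne'] at this
          linarith
        simp only [zero_mul, zero_add, mul_one]
        calc D / L * (Real.exp L - 1) ≤ D / L * (L * Real.exp L) := by gcongr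
          _ = D * Real.exp L := by field_simp
    have := hmain (K * r) (by positivity)
    simp only [zero_add, sub_zero]
    calc _ ≤ D * Real.exp (K * r) := this
      _ = _ := by rw [hD]; ring
  · refine LipschitzOnWith.mono ?_ (subset_univ _)
    refine ((A (q + t • (h + w)) (h + w)).lipschitz.weaken ?_).lipschitzOnWith
    refine NNReal.coe_le_coe.1 ?_
    simp only [coe_nnnorm]
    exact ContinuousLinearMap.le_of_opNorm_le_of_le _
      (hb _ (hmem h2 t (Ico_subset_Icc_self ht))).1 hhw

/-- **Frobenius theorem** for linear systems: a flat connection on a trivial vector bundle has local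
parallel sections with arbitrary initial values. -/
theorem exists_parallel_section [CompleteSpace F] {A : E → E →L[ℝ] F →L[ℝ] F} {V : Set E}
    (hV : IsOpen V) (hA : ContDiffOn ℝ ∞ A V)
    (hflat : ∀ y ∈ V, ∀ u v s, fderiv ℝ A y u v s + A y v (A y u s) =
      fderiv ℝ A y v u s + A y u (A y v s)) {q : E} (hq : q ∈ V) (s₀ : F) :
    ∃ r > 0, Metric.ball q r ⊆ V ∧ ∃ s : E → F, s q = s₀ ∧
      ∀ y ∈ Metric.ball q r, HasFDerivAt s ((A y).flip (s y)) y := by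
  obtain ⟨r₀, hr₀, hball, K, hK, hb⟩ := exists_ball_bounds hV hA hq
  -- The second bound makes the coefficient of the radial equation at most 1/2, as
  -- `exists_solution_linear_ode` requires.
  set r := min r₀ (1 / (2 * K)) with hr
  have hr0 : 0 < r := lt_min hr₀ (by positivity)
  have hsub : Metric.ball q r ⊆ Metric.ball q r₀ := Metric.ball_subset_ball (min_le_left _ _)
  have hKr : K * r ≤ 1 / 2 := by
    calc K * r ≤ K * (1 / (2 * K)) := by gcongr; exact min_le_right _ _
      _ = 1 / 2 := by field_simp
  have hmem : ∀ {k : E}, q + k ∈ Metric.ball q r → ∀ t ∈ Icc (0 : ℝ) 1,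
      q + t • k ∈ Metric.ball q r := by
    intro k hk t ht
    simp only [Metric.mem_ball, dist_self_add_left] at hk ⊢
    rw [norm_smul, Real.norm_of_nonneg ht.1]
    exact (mul_le_of_le_one_left (norm_nonneg _) ht.2).trans_lt hk
  have hex : ∀ h : E, ∃ u : ℝ → F, q + h ∈ Metric.ball q r → u 0 = s₀ ∧ ∀ t ∈ Icc (0 : ℝ) 1,
      HasDerivWithinAt u (A (q + t • h) h (u t)) (Icc 0 1) t := by
    intro h
    by_cases hh : q + h ∈ Metric.ball q r
    · have h1 : ‖h‖ ≤ r := by simpa using (Metric.mem_ball.1 hh).le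
      have h2 : ContinuousOn (fun t : ℝ ↦ A (q + t • h)) (Icc 0 1) :=
        hA.continuousOn.comp (by fun_prop) fun t ht ↦ hball (hsub (hmem hh t ht))
      obtain ⟨u, hu⟩ := exists_solution_linear_ode (B := fun t ↦ A (q + t • h) h)
        (h2.clm_apply continuousOn_const)
        (fun t ht ↦ (ContinuousLinearMap.le_of_opNorm_le_of_le _
          (hb _ (hsub (hmem hh t ht))).1 h1).trans hKr) s₀
      exact ⟨u, fun _ ↦ hu⟩
    · exact ⟨0, fun h ↦ absurd h hh⟩
  choose u hu using hex
  -- The section is obtained by transporting s₀ along the segment from q to y. Flatness enters only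
  -- in the differentiability claim, through the quadratic estimate for neighbouring rays.
  refine ⟨r, hr0, hsub.trans hball, fun y ↦ u (y - q) 1, ?_, fun y hy ↦ ?_⟩
  · obtain ⟨h1, h2⟩ := hu 0 (by simpa using hr0)
    simp only [sub_self]
    have hd : DifferentiableOn ℝ (u 0) (Icc 0 1) := fun t ht ↦ (h2 t ht).differentiableWithinAt
    have h3 : ∀ t ∈ Ico (0 : ℝ) 1, HasDerivWithinAt (u 0) 0 (Ici t) t := by
      intro t ht
      have := h2 t (Ico_subset_Icc_self ht)
      simp only [map_zero, _root_.zero_apply] at this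
      exact (this.mono (Icc_subset_Icc_left ht.1)).mono_of_mem_nhdsWithin (Icc_mem_nhdsGE ht.2)
    rw [← h1]
    exact constant_of_has_deriv_right_zero hd.continuousOn h3 1 (by simp)
  · have hy' : q + (y - q) ∈ Metric.ball q r := by simpa using hy
    have hu₁ := hu (y - q) hy'
    obtain ⟨N, hN⟩ := isCompact_Icc.exists_bound_of_continuousOn
      (f := u (y - q)) (s := Icc (0 : ℝ) 1) fun t ht ↦ (hu₁.2 t ht).continuousWithinAt
    have hO : (fun z ↦ u (z - q) 1 - u (y - q) 1 - (A y).flip (u (y - q) 1) (z - y))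
        =O[𝓝 y] fun z ↦ ‖z - y‖ ^ 2 := by
      refine Asymptotics.IsBigO.of_bound
        ((K * r * N + K ^ 2 * r * N + K * N + K ^ 2 * N) * Real.exp (K * r)) ?_
      filter_upwards [Metric.isOpen_ball.mem_nhds hy] with z hz
      have hz' : q + (y - q + (z - y)) ∈ Metric.ball q r := by
        rwa [show q + (y - q + (z - y)) = z by module]
      have e : y - q + (z - y) = z - q := by module
      have := norm_sub_radial_solution_le hK
        (fun x hx ↦ (hA.contDiffAt (hV.mem_nhds (hball (hsub hx)))).differentiableAt (by simp))
        (fun x hx ↦ ⟨(hb x (hsub hx)).1, fun y hy ↦ (hb x (hsub hx)).2 y (hsub hy)⟩)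
        (fun x hx ↦ hflat x (hball (hsub hx))) hy' hz' hu₁
        (u₂ := u (z - q)) (by rw [← e]; exact hu _ hz') hN
      rw [add_sub_cancel] at this
      rwa [ContinuousLinearMap.flip_apply, norm_pow, norm_norm]
    rw [hasFDerivAt_iff_isLittleO]
    refine hO.trans_isLittleO ?_
    have := Asymptotics.isLittleO_norm_pow_id (E' := E) (n := 2) (by norm_num)
    have h5 : Filter.Tendsto (fun z ↦ z - y) (𝓝 y) (𝓝 0) := by
      have : ContinuousAt (fun z ↦ z - y) y := by fun_prop
      simpa [ContinuousAt] using this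
    exact this.comp_tendsto h5

lemma _root_.ContDiffOn.clm_flip {D G : Type*} [NormedAddCommGroup D] [NormedSpace ℝ D]
    [NormedAddCommGroup G] [NormedSpace ℝ G] {n : WithTop ℕ∞} {A : D → E →L[ℝ] F →L[ℝ] G}
    {V : Set D} (hA : ContDiffOn ℝ n A V) : ContDiffOn ℝ n (fun y ↦ (A y).flip) V := by
  let L : (E →L[ℝ] F →L[ℝ] G) →L[ℝ] (F →L[ℝ] E →L[ℝ] G) :=
    (ContinuousLinearMap.flipₗᵢ ℝ E F G).toContinuousLinearEquiv.toContinuousLinearMap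
  exact (ContinuousLinearMap.contDiff (E := E →L[ℝ] F →L[ℝ] G) (F := F →L[ℝ] E →L[ℝ] G)
    L).comp_contDiffOn hA

/-- Solutions of a smooth total differential equation are smooth. -/
lemma contDiffOn_of_hasFDerivAt {A : E → E →L[ℝ] F →L[ℝ] F} {V : Set E}
    (hA : ContDiffOn ℝ ∞ A V) {s : E → F}
    (hs : ∀ y ∈ V, HasFDerivAt s ((A y).flip (s y)) y) : ContDiffOn ℝ ∞ s V := by
  rw [contDiffOn_infty]
  intro n
  induction n with
  | zero =>
    exact contDiffOn_zero.2 fun y hy ↦ (hs y hy).continuousAt.continuousWithinAt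
  | succ n ih =>
    push_cast
    -- Bootstrapping: the equation expresses the derivative of s through A and s, so it is as
    -- regular as s is already known to be.
    rw [contDiffOn_succ_iff_hasFDerivWithinAt (by simp)]
    intro y hy
    refine ⟨V, by rw [insert_eq_of_mem hy]; exact self_mem_nhdsWithin, by simp,
      fun y ↦ (A y).flip (s y), fun y hy ↦ (hs y hy).hasFDerivWithinAt, ?_⟩
    have h1 : ContDiffOn ℝ n A V := hA.of_le (by exact_mod_cast le_top)
    have h2 : ContDiffOn ℝ n (fun y ↦ (A y).flip) V := h1.clm_flip
    exact h2.clm_apply ih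

end Frobenius


/-! ### Projective changes, pointwise algebra and conjugate pairs in coordinates. -/

section LocalGeometry

set_option maxSynthPendingDepth 3

variable {E : Type*} [NormedAddCommGroup E] [NormedSpace ℝ E]

section Calculus

variable {F G W : Type*} [NormedAddCommGroup F] [NormedSpace ℝ F]
  [NormedAddCommGroup G] [NormedSpace ℝ G] [NormedAddCommGroup W] [NormedSpace ℝ W]

lemma fderiv_bilin_apply {B : E → F →L[ℝ] G →L[ℝ] W} {P : E → F} {Q : E → G} {y : E}
    (hB : DifferentiableAt ℝ B y) (hP : DifferentiableAt ℝ P y) (hQ : DifferentiableAt ℝ Q y)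
    (u : E) : fderiv ℝ (fun z ↦ B z (P z) (Q z)) y u =
      fderiv ℝ B y u (P y) (Q y) + B y (fderiv ℝ P y u) (Q y) + B y (P y) (fderiv ℝ Q y u) := by
  have h1 := hB.hasFDerivAt.clm_apply hP.hasFDerivAt
  have h2 := h1.clm_apply hQ.hasFDerivAt
  rw [h2.fderiv]
  simp
  abel

lemma fderiv_bilin_apply_const {B : E → F →L[ℝ] G →L[ℝ] W} {y : E}
    (hB : DifferentiableAt ℝ B y) (a : F) (b : G) (u : E) :
    fderiv ℝ (fun z ↦ B z a b) y u = fderiv ℝ B y u a b := by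
  rw [fderiv_bilin_apply hB (differentiableAt_const a) (differentiableAt_const b)]
  simp

lemma fderiv_lin_apply {B : E → F →L[ℝ] W} {P : E → F} {y : E}
    (hB : DifferentiableAt ℝ B y) (hP : DifferentiableAt ℝ P y) (u : E) :
    fderiv ℝ (fun z ↦ B z (P z)) y u = fderiv ℝ B y u (P y) + B y (fderiv ℝ P y u) := by
  rw [(hB.hasFDerivAt.clm_apply hP.hasFDerivAt).fderiv]
  simp [add_comm]

lemma fderiv_lin_apply_const {B : E → F →L[ℝ] W} {y : E}
    (hB : DifferentiableAt ℝ B y) (a : F) (u : E) :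
    fderiv ℝ (fun z ↦ B z a) y u = fderiv ℝ B y u a := by
  rw [fderiv_lin_apply hB (differentiableAt_const a)]
  simp

lemma fderiv_fderiv_apply_comm {f : E → W} {y : E} (hf : ContDiffAt ℝ ∞ f y) (u v : E) :
    fderiv ℝ (fun z ↦ fderiv ℝ f z u) y v = fderiv ℝ (fun z ↦ fderiv ℝ f z v) y u := by
  have hd : DifferentiableAt ℝ (fderiv ℝ f) y :=
    (hf.fderiv_right (m := ∞) le_rfl).differentiableAt (by simp)
  rw [fderiv_lin_apply_const hd, fderiv_lin_apply_const hd]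
  exact (hf.isSymmSndFDerivAt (by simpa using ENat.LEInfty.out)) v u

lemma contDiffOn_bilin_iff [FiniteDimensional ℝ F] [FiniteDimensional ℝ G]
    {B : E → F →L[ℝ] G →L[ℝ] W} {V : Set E} {n : WithTop ℕ∞} :
    ContDiffOn ℝ n B V ↔ ∀ a b, ContDiffOn ℝ n (fun y ↦ B y a b) V := by
  rw [contDiffOn_clm_apply]
  exact forall_congr' fun a ↦ contDiffOn_clm_apply

end Calculus

/-- The curvature, in coordinates, of the connection with Christoffel symbols `Γ`, where
`Γ y w u` is the derivative at `y` of the constant field `w` in the direction `u`. -/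
noncomputable def christoffelCurvature (Γ : E → E →L[ℝ] E →L[ℝ] E) (y u v w : E) : E :=
  fderiv ℝ Γ y u w v - fderiv ℝ Γ y v w u + Γ y (Γ y w v) u - Γ y (Γ y w u) v

/-- The symmetric bilinear map `(a, u) ↦ α(a) u + α(u) a`. -/
noncomputable def symmProd (α : E →L[ℝ] ℝ) : E →L[ℝ] E →L[ℝ] E :=
  α.smulRight (ContinuousLinearMap.id ℝ E) + (α.smulRight (ContinuousLinearMap.id ℝ E)).flip

lemma symmProd_apply (α : E →L[ℝ] ℝ) (a u : E) : symmProd α a u = α a • u + α u • a := by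
  simp [symmProd]

/-- The projective change of `Γ` by the 1-form `ρ`. -/
noncomputable def projectiveChange (Γ : E → E →L[ℝ] E →L[ℝ] E) (ρ : E → E →L[ℝ] ℝ) :
    E → E →L[ℝ] E →L[ℝ] E :=
  fun y ↦ Γ y + symmProd (ρ y)

lemma projectiveChange_apply (Γ : E → E →L[ℝ] E →L[ℝ] E) (ρ : E → E →L[ℝ] ℝ) (y a u : E) :
    projectiveChange Γ ρ y a u = Γ y a u + (ρ y a • u + ρ y u • a) := by
  simp [projectiveChange, symmProd_apply]

/-- The bilinear form `(u, w) ↦ (∇_u ρ)(w) - ρ(u) ρ(w)`. -/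
noncomputable def schoutenForm (Γ : E → E →L[ℝ] E →L[ℝ] E) (ρ : E → E →L[ℝ] ℝ) (y : E) :
    E →L[ℝ] E →L[ℝ] ℝ :=
  fderiv ℝ ρ y - (ContinuousLinearMap.compL ℝ E E ℝ (ρ y)) ∘L (Γ y).flip
    - (ρ y).smulRight (ρ y)

lemma schoutenForm_apply (Γ : E → E →L[ℝ] E →L[ℝ] E) (ρ : E → E →L[ℝ] ℝ) (y u w : E) :
    schoutenForm Γ ρ y u w = fderiv ℝ ρ y u w - ρ y (Γ y w u) - ρ y u * ρ y w := by
  simp [schoutenForm]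

lemma contDiffOn_projectiveChange [FiniteDimensional ℝ E] {Γ : E → E →L[ℝ] E →L[ℝ] E}
    {ρ : E → E →L[ℝ] ℝ} {V : Set E} {n : WithTop ℕ∞} (hΓ : ContDiffOn ℝ n Γ V)
    (hρ : ContDiffOn ℝ n ρ V) : ContDiffOn ℝ n (projectiveChange Γ ρ) V := by
  rw [contDiffOn_bilin_iff] at hΓ ⊢
  intro a b
  simp only [projectiveChange_apply]
  have h := contDiffOn_clm_apply.1 hρ
  exact (hΓ a b).add (((h a).smul contDiffOn_const).add ((h b).smul contDiffOn_const))

/-- Expanding, the derivatives of ρ, the products with Γ and the quadratic terms in ρ group into the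
Schouten form, using the symmetry of Γ. As ρ need not be closed, the skew part of that form survives
as a multiple of w. -/
lemma christoffelCurvature_projectiveChange {Γ : E → E →L[ℝ] E →L[ℝ] E} {ρ : E → E →L[ℝ] ℝ}
    {y : E} (hΓ : DifferentiableAt ℝ Γ y) (hρ : DifferentiableAt ℝ ρ y)
    (hd : DifferentiableAt ℝ (projectiveChange Γ ρ) y) (hsymm : ∀ a b, Γ y a b = Γ y b a)
    (u v w : E) :
    christoffelCurvature (projectiveChange Γ ρ) y u v w = christoffelCurvature Γ y u v w
      + (schoutenForm Γ ρ y u v - schoutenForm Γ ρ y v u) • w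
      + schoutenForm Γ ρ y u w • v - schoutenForm Γ ρ y v w • u := by
  have h1 : ∀ u a b, fderiv ℝ (projectiveChange Γ ρ) y u a b =
      fderiv ℝ Γ y u a b + (fderiv ℝ ρ y u a • b + fderiv ℝ ρ y u b • a) := by
    intro u a b
    have e1 : ∀ a, HasFDerivAt (fun z ↦ ρ z a) ((fderiv ℝ ρ y).flip a) y := fun a ↦ by
      simpa using hρ.hasFDerivAt.clm_apply (hasFDerivAt_const a y)
    have e2 : DifferentiableAt ℝ (fun z ↦ Γ z a b) y :=
      (hΓ.clm_apply (differentiableAt_const a)).clm_apply (differentiableAt_const b)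
    have e3 := e2.hasFDerivAt.fun_add (((e1 a).smul_const b).fun_add ((e1 b).smul_const a))
    rw [← fderiv_bilin_apply_const hd]
    simp only [projectiveChange_apply]
    rw [e3.fderiv]
    simp [fderiv_bilin_apply_const hΓ]
  simp only [christoffelCurvature, h1, projectiveChange_apply, schoutenForm_apply, map_add,
    map_smul, _root_.add_apply, _root_.smul_apply, hsymm u v]
  module

section Algebra

variable {g S : E →L[ℝ] E →L[ℝ] ℝ}

/-- If orthogonal vectors for an inner product `g` are conjugate for a bilinear form `S`, then `S`
is a multiple of `g`. -/
lemma eq_smul_of_orthogonal_imp (hg : ∀ a b, g a b = g b a) (hpos : ∀ a, a ≠ 0 → 0 < g a a)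
    (h : ∀ a b, g a b = 0 → S a b = 0) {e : E} (he : e ≠ 0) (a b : E) :
    S a b = S e e / g e e * g a b := by
  have hge := (hpos e he).ne'
  set k := S e e / g e e with hk
  -- T vanishes on orthogonal pairs and on (e, e). It remains to propagate this to every diagonal
  -- value, then to all pairs.
  set T : E →L[ℝ] E →L[ℝ] ℝ := S - k • g with hT
  have hTo : ∀ a b, g a b = 0 → T a b = 0 := fun a b hab ↦ by simp [hT, hab, h a b hab]
  have hTe : T e e = 0 := by simp [hT, hk, hge]
  suffices H : T a b = 0 by
    simp only [hT, _root_.sub_apply, _root_.smul_apply, smul_eq_mul] at H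
    linarith
  have hTd : ∀ v, T v v = 0 := by
    intro v
    set c := g v e / g e e with hc
    obtain ⟨w, hw⟩ : ∃ w, w = v - c • e := ⟨_, rfl⟩
    have hwe : g w e = 0 := by simp [hw, hc, hge]
    have hew : g e w = 0 := by rw [hg, hwe]
    have hTwe := hTo _ _ hwe
    have hTew := hTo _ _ hew
    have hTww : T w w = 0 := by
      -- The coefficient makes these two vectors orthogonal; since T(e,e), T(e,w) and T(w,e) vanish,
      -- only -T(w,w) is left.
      have := hTo (e + w) ((g w w / g e e) • e - w) (by
        simp [hwe, hew, hge])
      simp only [map_add, map_sub, map_smul, _root_.add_apply, hTe, hTwe, hTew, smul_eq_mul,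
        add_zero, mul_zero, zero_add, zero_sub] at this
      linarith
    have hv : v = c • e + w := by simp [hw]
    rw [hv]
    simp [hTe, hTwe, hTew, hTww]
  rcases eq_or_ne a 0 with rfl | ha
  · simp
  · have hga := (hpos a ha).ne'
    -- The component of b orthogonal to a; the removed part contributes a multiple of T(a,a) = 0.
    have h1 := hTo a (b - (g a b / g a a) • a) (by simp [hga])
    simpa [hTd a] using h1

/-- A curvature-like tensor which is a Kulkarni–Nomizu type product with a bilinear form `S`
and which is skew-symmetric for an inner product `g` comes from a multiple of `g`. -/
lemma eq_smul_of_skew (hg : ∀ a b, g a b = g b a) (hpos : ∀ a, a ≠ 0 → 0 < g a a)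
    (h : ∀ u v w, g ((S u v - S v u) • w + S u w • v - S v w • u) w = 0)
    {e : E} (he : e ≠ 0) (a b : E) : S a b = S e e / g e e * g a b := by
  refine eq_smul_of_orthogonal_imp hg hpos (fun u v huv ↦ ?_) he a b
  -- Take w = u in the skewness identity. Exchanging u and v gives S(v,u) = 2 S(u,v) as well, so
  -- both values vanish.
  have key : ∀ u v, g u v = 0 → u ≠ 0 → S u v = 2 * S v u := by
    intro u v huv hu
    have h1 := h u v u
    have hvu : g v u = 0 := by rw [hg, huv]
    simp only [map_add, map_sub, map_smul, _root_.add_apply, _root_.sub_apply,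
      _root_.smul_apply, smul_eq_mul, hvu] at h1
    have h2 : (S u v - 2 * S v u) * g u u = 0 := by linarith
    have := (mul_eq_zero.1 h2).resolve_right (hpos u hu).ne'
    linarith
  rcases eq_or_ne u 0 with rfl | hu
  · simp
  rcases eq_or_ne v 0 with rfl | hv
  · simp
  have h1 := key u v huv hu
  have h2 := key v u (by rw [hg, huv]) hv
  linarith

end Algebra

/-- Coordinate form of a pair of torsion-free connections which are dual with respect to a
Riemannian metric `g` and have the same curvature. -/
structure IsConjugatePairOn (g : E → E →L[ℝ] E →L[ℝ] ℝ) (Γ Γ' : E → E →L[ℝ] E →L[ℝ] E)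
    (V : Set E) : Prop where
  contDiffOn_metric : ContDiffOn ℝ ∞ g V
  contDiffOn : ContDiffOn ℝ ∞ Γ V
  contDiffOn' : ContDiffOn ℝ ∞ Γ' V
  metric_symm : ∀ y ∈ V, ∀ a b, g y a b = g y b a
  metric_pos : ∀ y ∈ V, ∀ a, a ≠ 0 → 0 < g y a a
  symm : ∀ y ∈ V, ∀ a b, Γ y a b = Γ y b a
  symm' : ∀ y ∈ V, ∀ a b, Γ' y a b = Γ' y b a
  compat : ∀ y ∈ V, ∀ u a b, fderiv ℝ g y u a b = g y (Γ y a u) b + g y a (Γ' y b u)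
  curvature_eq : ∀ y ∈ V, ∀ u v w,
    christoffelCurvature Γ y u v w = christoffelCurvature Γ' y u v w

namespace IsConjugatePairOn

variable {g : E → E →L[ℝ] E →L[ℝ] ℝ} {Γ Γ' : E → E →L[ℝ] E →L[ℝ] E} {V : Set E}

lemma differentiableAt (h : IsConjugatePairOn g Γ Γ' V) (hV : IsOpen V) {y : E} (hy : y ∈ V) :
    DifferentiableAt ℝ Γ y :=
  (h.contDiffOn.contDiffAt (hV.mem_nhds hy)).differentiableAt (by simp)

lemma differentiableAt_metric (h : IsConjugatePairOn g Γ Γ' V) (hV : IsOpen V) {y : E}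
    (hy : y ∈ V) : DifferentiableAt ℝ g y :=
  (h.contDiffOn_metric.contDiffAt (hV.mem_nhds hy)).differentiableAt (by simp)

lemma fderiv_metric_symm (h : IsConjugatePairOn g Γ Γ' V) (hV : IsOpen V) {y : E} (hy : y ∈ V)
    (u a b : E) : fderiv ℝ g y u a b = fderiv ℝ g y u b a := by
  have hd : DifferentiableAt ℝ g y :=
    (h.contDiffOn_metric.contDiffAt (hV.mem_nhds hy)).differentiableAt (by simp)
  rw [← fderiv_bilin_apply_const hd, ← fderiv_bilin_apply_const hd]
  congr 1
  refine Filter.EventuallyEq.fderiv_eq ?_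
  filter_upwards [hV.mem_nhds hy] with z hz using h.metric_symm z hz a b

/-- Duality is an involution. This transfers the constant curvature criterion to Γ' and yields the
second direction of the equivalence from the first. -/
lemma swap (h : IsConjugatePairOn g Γ Γ' V) (hV : IsOpen V) : IsConjugatePairOn g Γ' Γ V where
  contDiffOn_metric := h.contDiffOn_metric
  contDiffOn := h.contDiffOn'
  contDiffOn' := h.contDiffOn
  metric_symm := h.metric_symm
  metric_pos := h.metric_pos
  symm := h.symm'
  symm' := h.symm
  compat y hy u a b := by
    rw [h.fderiv_metric_symm hV hy, h.compat y hy, h.metric_symm y hy b, h.metric_symm y hy _ a,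
      add_comm]
  curvature_eq y hy u v w := (h.curvature_eq y hy u v w).symm

lemma mono (h : IsConjugatePairOn g Γ Γ' V) {W : Set E} (hW : W ⊆ V) :
    IsConjugatePairOn g Γ Γ' W where
  contDiffOn_metric := h.contDiffOn_metric.mono hW
  contDiffOn := h.contDiffOn.mono hW
  contDiffOn' := h.contDiffOn'.mono hW
  metric_symm y hy := h.metric_symm y (hW hy)
  metric_pos y hy := h.metric_pos y (hW hy)
  symm y hy := h.symm y (hW hy)
  symm' y hy := h.symm' y (hW hy)
  compat y hy := h.compat y (hW hy)
  curvature_eq y hy := h.curvature_eq y (hW hy)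

/-- Codazzi equation for the metric. -/
lemma codazzi (h : IsConjugatePairOn g Γ Γ' V) (hV : IsOpen V) {y : E} (hy : y ∈ V) (u v z : E) :
    fderiv ℝ g y v u z + g y v (Γ y z u) = fderiv ℝ g y u v z + g y u (Γ y z v) := by
  rw [h.fderiv_metric_symm hV hy v u z, h.fderiv_metric_symm hV hy u v z, h.compat y hy,
    h.compat y hy, h.symm' y hy u v, h.metric_symm y hy v, h.metric_symm y hy u]
  ring

/-- The curvature is skew-symmetric with respect to the metric. -/
lemma metric_curvature (h : IsConjugatePairOn g Γ Γ' V) (hV : IsOpen V) {y : E} (hy : y ∈ V)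
    (u v a b : E) : g y (christoffelCurvature Γ y u v a) b
      + g y a (christoffelCurvature Γ y u v b) = 0 := by
  have hyV := hV.mem_nhds hy
  have hg := h.contDiffOn_metric.contDiffAt hyV
  have hgd : DifferentiableAt ℝ g y := hg.differentiableAt (by simp)
  have hΓ : DifferentiableAt ℝ Γ y := (h.contDiffOn.contDiffAt hyV).differentiableAt (by simp)
  have hΓ' : DifferentiableAt ℝ Γ' y := (h.contDiffOn'.contDiffAt hyV).differentiableAt (by simp)
  have hΓc : ∀ a u, DifferentiableAt ℝ (fun z ↦ Γ z a u) y := fun a u ↦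
    (hΓ.clm_apply (differentiableAt_const a)).clm_apply (differentiableAt_const u)
  have hΓc' : ∀ a u, DifferentiableAt ℝ (fun z ↦ Γ' z a u) y := fun a u ↦
    (hΓ'.clm_apply (differentiableAt_const a)).clm_apply (differentiableAt_const u)
  have hgc : ContDiffAt ℝ ∞ (fun z ↦ g z a b) y :=
    (hg.clm_apply contDiffAt_const).clm_apply contDiffAt_const
  have hsecond : ∀ u v, fderiv ℝ (fun z ↦ fderiv ℝ (fun z ↦ g z a b) z u) y v =
      g y (Γ y (Γ y a u) v) b + g y (Γ y a u) (Γ' y b v) + g y (fderiv ℝ Γ y v a u) b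
      + (g y (Γ y a v) (Γ' y b u) + g y a (Γ' y (Γ' y b u) v)
        + g y a (fderiv ℝ Γ' y v b u)) := by
    intro u v
    have e : (fun z ↦ fderiv ℝ (fun z ↦ g z a b) z u) =ᶠ[𝓝 y]
        fun z ↦ g z (Γ z a u) b + g z a (Γ' z b u) := by
      filter_upwards [hyV] with z hz
      rw [fderiv_bilin_apply_const, h.compat z hz]
      exact (h.contDiffOn_metric.contDiffAt (hV.mem_nhds hz)).differentiableAt (by simp)
    have d1 : DifferentiableAt ℝ (fun z ↦ g z (Γ z a u) b) y :=
      (hgd.clm_apply (hΓc a u)).clm_apply (differentiableAt_const b)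
    have d2 : DifferentiableAt ℝ (fun z ↦ g z a (Γ' z b u)) y :=
      (hgd.clm_apply (differentiableAt_const a)).clm_apply (hΓc' b u)
    rw [e.fderiv_eq, fderiv_fun_add d1 d2, _root_.add_apply,
      fderiv_bilin_apply hgd (hΓc a u) (differentiableAt_const b),
      fderiv_bilin_apply hgd (differentiableAt_const a) (hΓc' b u),
      fderiv_bilin_apply_const hΓ, fderiv_bilin_apply_const hΓ', h.compat y hy, h.compat y hy]
    simp
  -- Equality of the mixed second derivatives of g(a,b) says g(R(u,v)a, b) + g(a, R̄(u,v)b) = 0;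
  -- conjugate symmetry then replaces R̄ by R.
  have h1 := fderiv_fderiv_apply_comm hgc u v
  rw [hsecond, hsecond] at h1
  rw [h.curvature_eq y hy u v b]
  simp only [christoffelCurvature, map_add, map_sub, _root_.add_apply, _root_.sub_apply]
  linarith

end IsConjugatePairOn

end LocalGeometry


/-! ### Constant curvature and projective flatness. -/

section ConstantCurvature

set_option maxSynthPendingDepth 3

variable {E : Type*} [NormedAddCommGroup E] [NormedSpace ℝ E] [FiniteDimensional ℝ E]

lemma fderiv_clm_comp {D F G : Type*} [NormedAddCommGroup D] [NormedSpace ℝ D]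
    [NormedAddCommGroup F] [NormedSpace ℝ F] [NormedAddCommGroup G] [NormedSpace ℝ G]
    (L : F →L[ℝ] G) {f : D → F} {y : D} (hf : DifferentiableAt ℝ f y) (u : D) :
    fderiv ℝ (fun z ↦ L (f z)) y u = L (fderiv ℝ f y u) := by
  have := L.hasFDerivAt.comp y hf.hasFDerivAt
  rw [show (fun z ↦ L (f z)) = L ∘ f from rfl, this.fderiv]
  rfl

/-- The connection form of the linear system `df = α`, `∇α = - k f g`. -/
noncomputable def hessianSystem (g : E → E →L[ℝ] E →L[ℝ] ℝ) (Γ : E → E →L[ℝ] E →L[ℝ] E) (k : ℝ)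
    (y : E) : E →L[ℝ] (ℝ × (E →L[ℝ] ℝ)) →L[ℝ] (ℝ × (E →L[ℝ] ℝ)) :=
  (LinearMap.mk₂ ℝ (fun (u : E) (s : ℝ × (E →L[ℝ] ℝ)) ↦
      ((s.2 u, s.2 ∘L Γ y u - (k * s.1) • g y u) : ℝ × (E →L[ℝ] ℝ)))
    (fun u u' s ↦ by ext <;> simp; ring)
    (fun c u s ↦ by ext <;> simp; ring)
    (fun u s s' ↦ by ext <;> simp; ring)
    (fun c u s ↦ by ext <;> simp; ring)).toContinuousBilinearMap

lemma hessianSystem_apply (g : E → E →L[ℝ] E →L[ℝ] ℝ) (Γ : E → E →L[ℝ] E →L[ℝ] E) (k : ℝ)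
    (y u : E) (s : ℝ × (E →L[ℝ] ℝ)) :
    hessianSystem g Γ k y u s = (s.2 u, s.2 ∘L Γ y u - (k * s.1) • g y u) := rfl

lemma contDiffOn_hessianSystem {g : E → E →L[ℝ] E →L[ℝ] ℝ} {Γ : E → E →L[ℝ] E →L[ℝ] E}
    {V : Set E} (hg : ContDiffOn ℝ ∞ g V) (hΓ : ContDiffOn ℝ ∞ Γ V) (k : ℝ) :
    ContDiffOn ℝ ∞ (hessianSystem g Γ k) V := by
  rw [contDiffOn_bilin_iff] at hg hΓ ⊢
  intro u s
  simp only [hessianSystem_apply]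
  refine contDiffOn_const.prodMk (contDiffOn_clm_apply.2 fun z ↦ ?_)
  simp only [_root_.sub_apply, ContinuousLinearMap.comp_apply, _root_.smul_apply]
  exact (s.2.contDiff.comp_contDiffOn (hΓ u z)).sub ((hg u z).const_smul (k * s.1))

variable {g : E → E →L[ℝ] E →L[ℝ] ℝ} {Γ Γ' : E → E →L[ℝ] E →L[ℝ] E} {V : Set E}

lemma fderiv_hessianSystem {y : E} (k : ℝ) (hg : DifferentiableAt ℝ g y)
    (hΓ : DifferentiableAt ℝ Γ y) (hA : DifferentiableAt ℝ (hessianSystem g Γ k) y) (u v : E)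
    (s : ℝ × (E →L[ℝ] ℝ)) :
    fderiv ℝ (hessianSystem g Γ k) y u v s =
      (0, s.2 ∘L fderiv ℝ Γ y u v - (k * s.1) • fderiv ℝ g y u v) := by
  have hA' : DifferentiableAt ℝ (fun z ↦ hessianSystem g Γ k z v s) y :=
    (hA.clm_apply (differentiableAt_const v)).clm_apply (differentiableAt_const s)
  rw [← fderiv_bilin_apply_const hA]
  refine Prod.ext ?_ (ContinuousLinearMap.ext fun z ↦ ?_)
  · have := fderiv_clm_comp (ContinuousLinearMap.fst ℝ ℝ (E →L[ℝ] ℝ)) hA' u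
    simp only [hessianSystem_apply, ContinuousLinearMap.coe_fst'] at this
    simp only [hessianSystem_apply]
    rw [← this]
    simp
  · have := fderiv_clm_comp ((ContinuousLinearMap.apply ℝ ℝ z) ∘L
      (ContinuousLinearMap.snd ℝ ℝ (E →L[ℝ] ℝ))) hA' u
    simp only [hessianSystem_apply, ContinuousLinearMap.comp_apply, ContinuousLinearMap.coe_snd',
      ContinuousLinearMap.apply_apply, _root_.sub_apply, _root_.smul_apply] at this
    simp only [hessianSystem_apply, _root_.sub_apply, ContinuousLinearMap.comp_apply,
      _root_.smul_apply]
    rw [← this]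
    have e1 : DifferentiableAt ℝ (fun z' ↦ Γ z' v z) y :=
      (hΓ.clm_apply (differentiableAt_const v)).clm_apply (differentiableAt_const z)
    have e2 : DifferentiableAt ℝ (fun z' ↦ g z' v z) y :=
      (hg.clm_apply (differentiableAt_const v)).clm_apply (differentiableAt_const z)
    have e3 := (s.2.hasFDerivAt.comp y e1.hasFDerivAt).sub
      (e2.hasFDerivAt.const_smul (k * s.1))
    have e4 : (fun z' ↦ s.2 (Γ z' v z) - (k * s.1) • g z' v z) =
        (s.2 ∘ fun z' ↦ Γ z' v z) - (k * s.1) • fun z' ↦ g z' v z := rfl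
    rw [e4, e3.fderiv]
    simp [fderiv_bilin_apply_const hΓ, fderiv_bilin_apply_const hg]

namespace IsConjugatePairOn

/-- A connection of constant curvature in a conjugate pair is projectively flat. -/
lemma exists_projectively_flat_of_const_curvature (h : IsConjugatePairOn g Γ Γ' V)
    (hV : IsOpen V) {k : ℝ} (hk : ∀ y ∈ V, ∀ u v w, christoffelCurvature Γ y u v w =
      k • (g y v w • u - g y u w • v)) {q : E} (hq : q ∈ V) :
    ∃ W, IsOpen W ∧ q ∈ W ∧ W ⊆ V ∧ ∃ ρ : E → E →L[ℝ] ℝ, ContDiffOn ℝ ∞ ρ W ∧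
      ∀ y ∈ W, ∀ u v w, christoffelCurvature (projectiveChange Γ ρ) y u v w = 0 := by
  have hA := contDiffOn_hessianSystem h.contDiffOn_metric h.contDiffOn k
  obtain ⟨r, hr, hball, s, hsq, hs⟩ := exists_parallel_section hV hA (fun y hy u v s ↦ by
    have hAd := (hA.contDiffAt (hV.mem_nhds hy)).differentiableAt (by simp)
    rw [fderiv_hessianSystem k (h.differentiableAt_metric hV hy) (h.differentiableAt hV hy) hAd,
      fderiv_hessianSystem k (h.differentiableAt_metric hV hy) (h.differentiableAt hV hy) hAd]
    refine Prod.ext ?_ (ContinuousLinearMap.ext fun z ↦ ?_)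
    · simp [hessianSystem_apply, h.metric_symm y hy u v, h.symm y hy u v]
    -- The integrability condition for the α component: the constant curvature identity paired with
    -- α accounts for the terms in R and α∧g, and k f times the Codazzi equation for the derivatives
    -- of g. No dk term appears because k is constant.
    · have h1 := h.codazzi hV hy u v z
      have h2 := congrArg s.2 (hk y hy u v z)
      simp only [christoffelCurvature, map_add, map_sub, map_smul, smul_eq_mul] at h2
      rw [h.symm y hy (Γ y z v) u, h.symm y hy (Γ y z u) v, h.symm y hy z u,
        h.symm y hy z v, (h.differentiableAt hV hy |> fun hd ↦
          show fderiv ℝ Γ y u z v = fderiv ℝ Γ y u v z from ?_),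
        show fderiv ℝ Γ y v z u = fderiv ℝ Γ y v u z from ?_] at h2
      · rw [h.symm y hy z u, h.symm y hy z v] at h1
        simp [hessianSystem_apply]
        linear_combination h2 + k * s.1 * h1
      all_goals
        rw [← fderiv_bilin_apply_const (h.differentiableAt hV hy),
          ← fderiv_bilin_apply_const (h.differentiableAt hV hy)]
        congr 1
        refine Filter.EventuallyEq.fderiv_eq ?_
        filter_upwards [hV.mem_nhds hy] with x hx using h.symm x hx _ _) hq
    -- The value f(q) = 1 keeps f nonzero near q, so that ρ = -α/f is defined there; the value of α
    -- is immaterial.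
    ((1, 0) : ℝ × (E →L[ℝ] ℝ))
  have hsm : ContDiffOn ℝ ∞ s (Metric.ball q r) := contDiffOn_of_hasFDerivAt (hA.mono hball) hs
  have hf : ContDiffOn ℝ ∞ (fun y ↦ (s y).1) (Metric.ball q r) := hsm.fst
  have hα : ContDiffOn ℝ ∞ (fun y ↦ (s y).2) (Metric.ball q r) := hsm.snd
  have hW : IsOpen (Metric.ball q r ∩ (fun y ↦ (s y).1) ⁻¹' {0}ᶜ) :=
    hf.continuousOn.isOpen_inter_preimage Metric.isOpen_ball isOpen_compl_singleton
  refine ⟨_, hW, ⟨Metric.mem_ball_self hr, by simp [hsq]⟩, inter_subset_left.trans hball,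
    fun y ↦ -((s y).1⁻¹ • (s y).2), ?_, fun y hy u v w ↦ ?_⟩
  · exact (((hf.mono inter_subset_left).inv fun y hy ↦ hy.2).smul (hα.mono inter_subset_left)).neg
  set ρ : E → E →L[ℝ] ℝ := fun y ↦ -((s y).1⁻¹ • (s y).2) with hρdef
  have hρ : ContDiffOn ℝ ∞ ρ (Metric.ball q r ∩ (fun y ↦ (s y).1) ⁻¹' {0}ᶜ) :=
    (((hf.mono inter_subset_left).inv fun y hy ↦ hy.2).smul (hα.mono inter_subset_left)).neg
  have hyV := hball hy.1
  have hρd : DifferentiableAt ℝ ρ y := (hρ.contDiffAt (hW.mem_nhds hy)).differentiableAt (by simp)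
  have hPd : DifferentiableAt ℝ (projectiveChange Γ ρ) y :=
    ((contDiffOn_projectiveChange (h.contDiffOn.mono (inter_subset_left.trans hball))
      hρ).contDiffAt (hW.mem_nhds hy)).differentiableAt (by simp)
  -- For ρ = -α/f one has ∇ρ = -∇α/f + α⊗α/f², that is, k g + ρ⊗ρ.
  have hS : ∀ u z, schoutenForm Γ ρ y u z = k * g y u z := by
    intro u z
    have hy0 : (s y).1 ≠ 0 := hy.2
    have d1 := (ContinuousLinearMap.fst ℝ ℝ (E →L[ℝ] ℝ)).hasFDerivAt.comp y (hs y hy.1)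
    have d2 := ((ContinuousLinearMap.apply ℝ ℝ z) ∘L
      (ContinuousLinearMap.snd ℝ ℝ (E →L[ℝ] ℝ))).hasFDerivAt.comp y (hs y hy.1)
    have d3 := (((hasDerivAt_inv hy0).comp_hasFDerivAt y d1).mul d2).neg
    have e : fderiv ℝ ρ y u z = (((s y).1 ^ 2)⁻¹ * ((s y).2 u)) * (s y).2 z -
        (s y).1⁻¹ * ((s y).2 (Γ y u z) - (k * (s y).1) * g y u z) := by
      rw [← fderiv_lin_apply_const hρd]
      have : (fun x ↦ ρ x z) = -(((fun y ↦ y⁻¹) ∘ (ContinuousLinearMap.fst ℝ ℝ (E →L[ℝ] ℝ)) ∘ s) *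
        (((ContinuousLinearMap.apply ℝ ℝ z) ∘L (ContinuousLinearMap.snd ℝ ℝ (E →L[ℝ] ℝ))) ∘ s)) := by
        ext x; simp [ρ]
      rw [this, d3.fderiv]
      simp [hessianSystem_apply]
      ring
    rw [schoutenForm_apply, e, h.symm y hyV z u]
    simp only [ρ, _root_.neg_apply, _root_.smul_apply, smul_eq_mul]
    field_simp
    ring
  rw [christoffelCurvature_projectiveChange (h.differentiableAt hV hyV) hρd hPd (h.symm y hyV),
    hk y hyV, hS, hS, hS, hS, h.metric_symm y hyV v u]
  module

/-- The curvature of a projectively flat connection in a conjugate pair is a multiple of the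
one of the metric, and the Schouten form is the same multiple of the metric. -/
lemma schoutenForm_eq (h : IsConjugatePairOn g Γ Γ' V) (hV : IsOpen V) {ρ : E → E →L[ℝ] ℝ}
    (hρ : ContDiffOn ℝ ∞ ρ V)
    (hflat : ∀ y ∈ V, ∀ u v w, christoffelCurvature (projectiveChange Γ ρ) y u v w = 0)
    {e : E} (he : e ≠ 0) {y : E} (hy : y ∈ V) :
    (∀ a b, schoutenForm Γ ρ y a b = schoutenForm Γ ρ y e e / g y e e * g y a b) ∧
    ∀ u v w, christoffelCurvature Γ y u v w =
      (schoutenForm Γ ρ y e e / g y e e) • (g y v w • u - g y u w • v) := by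
  have hρd : DifferentiableAt ℝ ρ y := (hρ.contDiffAt (hV.mem_nhds hy)).differentiableAt (by simp)
  have hPd : DifferentiableAt ℝ (projectiveChange Γ ρ) y :=
    ((contDiffOn_projectiveChange h.contDiffOn hρ).contDiffAt
      (hV.mem_nhds hy)).differentiableAt (by simp)
  have hc := fun u v w ↦ christoffelCurvature_projectiveChange (h.differentiableAt hV hy) hρd hPd
    (h.symm y hy) u v w
  simp only [hflat y hy] at hc
  have hS := fun a b ↦ eq_smul_of_skew (S := schoutenForm Γ ρ y) (h.metric_symm y hy)
    (h.metric_pos y hy) (fun u v w ↦ by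
      have h1 := h.metric_curvature hV hy u v w w
      rw [h.metric_symm y hy w] at h1
      have h2 := congrArg (fun x ↦ g y x w) (hc u v w)
      simp only [map_zero, map_add, map_sub, _root_.add_apply, _root_.sub_apply,
        _root_.zero_apply] at h2 ⊢
      linarith) he a b
  refine ⟨hS, fun u v w ↦ ?_⟩
  have h3 := hc u v w
  rw [hS u v, hS v u, hS u w, hS v w, h.metric_symm y hy v u, sub_self, zero_smul, add_zero] at h3
  rw [← sub_eq_zero, h3]
  module

lemma exists_const_curvature (h : IsConjugatePairOn g Γ Γ' V) (hV : IsOpen V)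
    {ρ : E → E →L[ℝ] ℝ} (hρ : ContDiffOn ℝ ∞ ρ V)
    (hflat : ∀ y ∈ V, ∀ u v w, christoffelCurvature (projectiveChange Γ ρ) y u v w = 0)
    (hE : 1 < Module.finrank ℝ E) {q : E} (hq : q ∈ V) :
    ∃ W, IsOpen W ∧ q ∈ W ∧ W ⊆ V ∧ ∃ k : ℝ, ∀ y ∈ W, ∀ u v w,
      christoffelCurvature Γ y u v w = k • (g y v w • u - g y u w • v) := by
  have : Nontrivial E := Module.nontrivial_of_finrank_pos (R := ℝ) (by omega)
  obtain ⟨e, he⟩ := exists_ne (0 : E)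
  -- Evaluating on one fixed vector e presents the pointwise factor as an explicit function, whose
  -- differentiability is then visible.
  set k : E → ℝ := fun y ↦ schoutenForm Γ ρ y e e / g y e e with hk
  have hρ' := contDiffOn_clm_apply.1 hρ
  have hρd : ∀ y ∈ V, DifferentiableAt ℝ ρ y := fun y hy ↦
    (hρ.contDiffAt (hV.mem_nhds hy)).differentiableAt (by simp)
  have hdρ : ∀ y ∈ V, DifferentiableAt ℝ (fderiv ℝ ρ) y := fun y hy ↦
    ((hρ.contDiffAt (hV.mem_nhds hy)).fderiv_right (m := ∞) le_rfl).differentiableAt (by simp)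
  have hkd : ∀ y ∈ V, DifferentiableAt ℝ k y := by
    intro y hy
    have hΓ := h.differentiableAt hV hy
    have hg := h.differentiableAt_metric hV hy
    have c := differentiableAt_const (𝕜 := ℝ) (x := y) e
    simp only [hk, schoutenForm_apply, div_eq_mul_inv]
    exact ((((hdρ y hy).clm_apply c).clm_apply c).sub ((hρd y hy).clm_apply
      ((hΓ.clm_apply c).clm_apply c)) |>.sub (((hρd y hy).clm_apply c).mul
      ((hρd y hy).clm_apply c))).mul
      (((hg.clm_apply c).clm_apply c).inv (h.metric_pos y hy e he).ne')
  have hdk : ∀ y ∈ V, fderiv ℝ k y = 0 := by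
    intro y hy
    have hΓ := h.differentiableAt hV hy
    have hg := h.differentiableAt_metric hV hy
    have hrd := hρd y hy
    have hS : ∀ x ∈ V, ∀ u z, fderiv ℝ ρ x u z =
        ρ x (Γ x z u) + ρ x u * ρ x z + k x * g x u z := by
      intro x hx u z
      have := (h.schoutenForm_eq hV hρ hflat he hx).1 u z
      rw [schoutenForm_apply] at this
      simp only [hk]
      linarith
    have hsecond : ∀ u v z, fderiv ℝ (fun x ↦ fderiv ℝ (fun x ↦ ρ x z) x u) y v =
        fderiv ℝ ρ y v (Γ y z u) + ρ y (fderiv ℝ Γ y v z u)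
        + (fderiv ℝ ρ y v u * ρ y z + ρ y u * fderiv ℝ ρ y v z)
        + (fderiv ℝ k y v * g y u z + k y * fderiv ℝ g y v u z) := by
      intro u v z
      have e1 : (fun x ↦ fderiv ℝ (fun x ↦ ρ x z) x u) =ᶠ[𝓝 y]
          fun x ↦ ρ x (Γ x z u) + ρ x u * ρ x z + k x * g x u z := by
        filter_upwards [hV.mem_nhds hy] with x hx
        rw [fderiv_lin_apply_const (hρd x hx), hS x hx]
      have d1 : DifferentiableAt ℝ (fun x ↦ Γ x z u) y :=
        (hΓ.clm_apply (differentiableAt_const _)).clm_apply (differentiableAt_const _)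
      have d2 : DifferentiableAt ℝ (fun x ↦ ρ x (Γ x z u)) y := hrd.clm_apply d1
      have d3 : ∀ u, DifferentiableAt ℝ (fun x ↦ ρ x u) y := fun u ↦
        hrd.clm_apply (differentiableAt_const _)
      have d4 : DifferentiableAt ℝ (fun x ↦ g x u z) y :=
        (hg.clm_apply (differentiableAt_const _)).clm_apply (differentiableAt_const _)
      rw [e1.fderiv_eq, fderiv_fun_add (d2.fun_add ((d3 u).fun_mul (d3 z))) ((hkd y hy).fun_mul d4),
        fderiv_fun_add d2 ((d3 u).fun_mul (d3 z)), fderiv_fun_mul (d3 u) (d3 z),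
        fderiv_fun_mul (hkd y hy) d4]
      simp only [_root_.add_apply, _root_.smul_apply, smul_eq_mul]
      rw [fderiv_lin_apply hrd d1, fderiv_bilin_apply_const hΓ, fderiv_bilin_apply_const hg,
        fderiv_lin_apply_const hrd, fderiv_lin_apply_const hrd]
      ring
    have key : ∀ u v z, fderiv ℝ k y v * g y u z = fderiv ℝ k y u * g y v z := by
      intro u v z
      -- Ricci identity for ρ: after substituting the equation for its first derivatives, the
      -- curvature term and k times the Codazzi equation cancel everything except the terms with dk.
      have h1 := fderiv_fderiv_apply_comm
        ((hρ' z).contDiffAt (hV.mem_nhds hy)) u v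
      rw [hsecond, hsecond] at h1
      simp only [hS y hy, h.symm y hy v u] at h1
      have h2 := congrArg (ρ y) ((h.schoutenForm_eq hV hρ hflat he hy).2 v u z)
      simp only [christoffelCurvature, map_add, map_sub, map_smul, smul_eq_mul] at h2
      change _ = k y * _ at h2
      have h3 := h.codazzi hV hy u v z
      rw [h.metric_symm y hy v u] at h1
      linear_combination h1 - h2 - k y * h3
    ext v
    -- Dimension at least 2 enters here: a nonzero u orthogonal to v exists, and two dimensions
    -- suffice.
    obtain ⟨u, hu, hu0⟩ := (Submodule.ne_bot_iff _).1 (LinearMap.ker_ne_bot_of_finrank_lt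
      (f := (g y v).toLinearMap) (by simpa using hE))
    have h1 := key u v u
    have h2 : g y v u = 0 := hu
    rw [h2, mul_zero] at h1
    simpa using (mul_eq_zero.1 h1).resolve_right (h.metric_pos y hy u hu0).ne'
  obtain ⟨r, hr, hball⟩ := Metric.isOpen_iff.1 hV q hq
  refine ⟨Metric.ball q r, Metric.isOpen_ball, Metric.mem_ball_self hr, hball, k q,
    fun y hy u v w ↦ ?_⟩
  have hconst : k y = k q := Metric.isOpen_ball.is_const_of_fderiv_eq_zero
    (convex_ball q r).isPreconnected
    (fun x hx ↦ (hkd x (hball hx)).differentiableWithinAt) (fun x hx ↦ hdk x (hball hx)) hy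
    (Metric.mem_ball_self hr)
  rw [(h.schoutenForm_eq hV hρ hflat he (hball hy)).2, ← hconst]

/-- In a conjugate pair, projective flatness of one connection implies that of the other one. -/
theorem exists_projectively_flat_dual (h : IsConjugatePairOn g Γ Γ' V) (hV : IsOpen V)
    {ρ : E → E →L[ℝ] ℝ} (hρ : ContDiffOn ℝ ∞ ρ V)
    (hflat : ∀ y ∈ V, ∀ u v w, christoffelCurvature (projectiveChange Γ ρ) y u v w = 0)
    {q : E} (hq : q ∈ V) :
    ∃ W, IsOpen W ∧ q ∈ W ∧ W ⊆ V ∧ ∃ ρ' : E → E →L[ℝ] ℝ, ContDiffOn ℝ ∞ ρ' W ∧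
      ∀ y ∈ W, ∀ u v w, christoffelCurvature (projectiveChange Γ' ρ') y u v w = 0 := by
  rcases lt_or_ge 1 (Module.finrank ℝ E) with hE | hE
  · obtain ⟨W, hW, hqW, hWV, k, hk⟩ := h.exists_const_curvature hV hρ hflat hE hq
    have h' := (h.swap hV).mono hWV
    obtain ⟨W', hW', hqW', hWW', H⟩ := h'.exists_projectively_flat_of_const_curvature hW
      (fun y hy u v w ↦ by rw [← h.curvature_eq y (hWV hy), hk y hy]) hqW
    exact ⟨W', hW', hqW', hWW'.trans hWV, H⟩
  -- Here u and v are multiples of one vector, and the curvature is skew in them; no projective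
  -- change is needed.
  · obtain ⟨e, he⟩ := finrank_le_one_iff.1 hE
    refine ⟨V, hV, hq, subset_rfl, 0, contDiffOn_const, fun y hy u v w ↦ ?_⟩
    obtain ⟨a, rfl⟩ := he u
    obtain ⟨b, rfl⟩ := he v
    simp only [christoffelCurvature, map_smul, _root_.smul_apply]
    module

end IsConjugatePairOn

end ConstantCurvature


/-! ### Vector fields, derivatives and Lie brackets read in a chart. -/

section Chart

set_option maxSynthPendingDepth 3

variable {E : Type*} [NormedAddCommGroup E] [NormedSpace ℝ E]
  {M : Type*} [TopologicalSpace M] [ChartedSpace E M]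

/-- Reading a tangent vector in the chart at `p`. -/
noncomputable def toCoord [IsManifold 𝓘(ℝ, E) 1 M] (p x : M) : TangentSpace 𝓘(ℝ, E) x →L[ℝ] E :=
  (trivializationAt E (TangentSpace 𝓘(ℝ, E)) p).continuousLinearMapAt ℝ x

/-- The tangent vector with given coordinates in the chart at `p`. -/
noncomputable def ofCoord [IsManifold 𝓘(ℝ, E) 1 M] (p x : M) : E →L[ℝ] TangentSpace 𝓘(ℝ, E) x :=
  (trivializationAt E (TangentSpace 𝓘(ℝ, E)) p).symmL ℝ x

variable {p x : M}

lemma extChartAt_symm_apply (hx : x ∈ (chartAt E p).source) :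
    (extChartAt 𝓘(ℝ, E) p).symm (extChartAt 𝓘(ℝ, E) p x) = x :=
  (extChartAt 𝓘(ℝ, E) p).left_inv (by simpa using hx)

lemma extChartAt_mem_target (hx : x ∈ (chartAt E p).source) :
    extChartAt 𝓘(ℝ, E) p x ∈ (extChartAt 𝓘(ℝ, E) p).target :=
  (extChartAt 𝓘(ℝ, E) p).map_source (by simpa using hx)

lemma extChartAt_symm_mem {y : E} (hy : y ∈ (extChartAt 𝓘(ℝ, E) p).target) :
    (extChartAt 𝓘(ℝ, E) p).symm y ∈ (chartAt E p).source := by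
  simpa using (extChartAt 𝓘(ℝ, E) p).map_target hy

variable [IsManifold 𝓘(ℝ, E) ∞ M]

lemma toCoord_ofCoord (hx : x ∈ (chartAt E p).source) (w : E) :
    toCoord p x (ofCoord p x w) = w :=
  (trivializationAt E (TangentSpace 𝓘(ℝ, E)) p).continuousLinearMapAt_symmL
    (by simpa using hx) w

lemma ofCoord_toCoord (hx : x ∈ (chartAt E p).source) (v : TangentSpace 𝓘(ℝ, E) x) :
    ofCoord p x (toCoord p x v) = v :=
  (trivializationAt E (TangentSpace 𝓘(ℝ, E)) p).symmL_continuousLinearMapAt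
    (by simpa using hx) v

lemma toCoord_injective (hx : x ∈ (chartAt E p).source) :
    Function.Injective (toCoord (E := E) p x) :=
  Function.LeftInverse.injective (g := ofCoord p x) fun v ↦ ofCoord_toCoord hx v

/-- The representation of a vector field in the chart at `p`. -/
noncomputable def coordRep (p : M) (Y : Π x : M, TangentSpace 𝓘(ℝ, E) x) (y : E) : E :=
  toCoord p ((extChartAt 𝓘(ℝ, E) p).symm y) (Y ((extChartAt 𝓘(ℝ, E) p).symm y))

/-- The vector field with a given representation in the chart at `p`. -/
noncomputable def coordField (p : M) (V : E → E) : Π x : M, TangentSpace 𝓘(ℝ, E) x :=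
  fun x ↦ ofCoord p x (V (extChartAt 𝓘(ℝ, E) p x))

lemma coordRep_extChartAt (hx : x ∈ (chartAt E p).source)
    (Y : Π x : M, TangentSpace 𝓘(ℝ, E) x) :
    coordRep p Y (extChartAt 𝓘(ℝ, E) p x) = toCoord p x (Y x) := by
  simp only [coordRep]
  rw [extChartAt_symm_apply hx]

lemma coordRep_coordField {y : E} (hy : y ∈ (extChartAt 𝓘(ℝ, E) p).target) (V : E → E) :
    coordRep p (coordField p V) y = V y := by
  simp only [coordRep, coordField]
  rw [toCoord_ofCoord (extChartAt_symm_mem hy), (extChartAt 𝓘(ℝ, E) p).right_inv hy]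

variable {F : Type*} [NormedAddCommGroup F] [NormedSpace ℝ F]

lemma contMDiffAt_iff_contDiffAt_comp_symm {h : M → F} (hx : x ∈ (chartAt E p).source) :
    ContMDiffAt 𝓘(ℝ, E) 𝓘(ℝ, F) ∞ h x ↔
      ContDiffAt ℝ ∞ (h ∘ (extChartAt 𝓘(ℝ, E) p).symm) (extChartAt 𝓘(ℝ, E) p x) := by
  rw [contMDiffAt_iff_source_of_mem_source hx, contMDiffWithinAt_iff_contDiffWithinAt]
  simp [contDiffWithinAt_univ]

lemma mdifferentiableAt_iff_differentiableAt_comp_symm {h : M → F}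
    (hx : x ∈ (chartAt E p).source) :
    MDifferentiableAt 𝓘(ℝ, E) 𝓘(ℝ, F) h x ↔
      DifferentiableAt ℝ (h ∘ (extChartAt 𝓘(ℝ, E) p).symm) (extChartAt 𝓘(ℝ, E) p x) := by
  rw [mdifferentiableAt_iff_source_of_mem_source hx,
    mdifferentiableWithinAt_iff_differentiableWithinAt]
  simp [differentiableWithinAt_univ]

lemma toCoord_eq_mfderiv (hx : x ∈ (chartAt E p).source) :
    toCoord p x = mfderiv 𝓘(ℝ, E) 𝓘(ℝ, E) (extChartAt 𝓘(ℝ, E) p) x :=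
  TangentBundle.continuousLinearMapAt_trivializationAt hx

lemma mvfderiv_eq_fderiv {h : M → F} (hx : x ∈ (chartAt E p).source)
    (hh : MDifferentiableAt 𝓘(ℝ, E) 𝓘(ℝ, F) h x) (v : TangentSpace 𝓘(ℝ, E) x) :
    mvfderiv 𝓘(ℝ, E) h x v = fderiv ℝ (h ∘ (extChartAt 𝓘(ℝ, E) p).symm)
      (extChartAt 𝓘(ℝ, E) p x) (toCoord p x v) := by
  have hd := (mdifferentiableAt_iff_differentiableAt_comp_symm hx).1 hh
  have hφ : MDifferentiableAt 𝓘(ℝ, E) 𝓘(ℝ, E) (extChartAt 𝓘(ℝ, E) p) x :=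
    mdifferentiableAt_extChartAt hx
  have e : h =ᶠ[𝓝 x] (h ∘ (extChartAt 𝓘(ℝ, E) p).symm) ∘ (extChartAt 𝓘(ℝ, E) p) := by
    filter_upwards [(chartAt E p).open_source.mem_nhds hx] with z hz
    simp only [Function.comp]
    rw [extChartAt_symm_apply hz]
  have h1 : mfderiv 𝓘(ℝ, E) 𝓘(ℝ, F) h x = _ := e.mfderiv_eq
  rw [mfderiv_comp x hd.mdifferentiableAt hφ, mfderiv_eq_fderiv] at h1
  rw [toCoord_eq_mfderiv hx]
  simp only [mvfderiv]
  rw [h1]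
  rfl

lemma trivializationAt_apply_snd (hx : x ∈ (chartAt E p).source)
    (v : TangentSpace 𝓘(ℝ, E) x) :
    (trivializationAt E (TangentSpace 𝓘(ℝ, E)) p (TotalSpace.mk' E x v)).2 = toCoord p x v := by
  rw [toCoord, Trivialization.continuousLinearMapAt_apply,
    Trivialization.coe_linearMapAt_of_mem _ (by simpa using hx)]

lemma contMDiffAt_section_iff_coordRep {Y : Π x : M, TangentSpace 𝓘(ℝ, E) x}
    (hx : x ∈ (chartAt E p).source) :
    CMDiffAt ∞ (T% Y) x ↔ ContDiffAt ℝ ∞ (coordRep p Y) (extChartAt 𝓘(ℝ, E) p x) := by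
  rw [(trivializationAt E (TangentSpace 𝓘(ℝ, E)) p).contMDiffAt_section_iff (by simpa using hx)]
  have e : (fun x ↦ (trivializationAt E (TangentSpace 𝓘(ℝ, E)) p (TotalSpace.mk' E x (Y x))).2)
      =ᶠ[𝓝 x] fun x ↦ toCoord p x (Y x) := by
    filter_upwards [(chartAt E p).open_source.mem_nhds hx] with z hz
      using trivializationAt_apply_snd hz _
  rw [e.contMDiffAt_iff, contMDiffAt_iff_contDiffAt_comp_symm hx]
  rfl

lemma mdifferentiableAt_section_iff_coordRep {Y : Π x : M, TangentSpace 𝓘(ℝ, E) x}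
    (hx : x ∈ (chartAt E p).source) :
    MDiffAt (T% Y) x ↔ DifferentiableAt ℝ (coordRep p Y) (extChartAt 𝓘(ℝ, E) p x) := by
  rw [(trivializationAt E (TangentSpace 𝓘(ℝ, E)) p).mdifferentiableAt_section_iff _ _
    (by simpa using hx)]
  have e : (fun x ↦ (trivializationAt E (TangentSpace 𝓘(ℝ, E)) p (TotalSpace.mk' E x (Y x))).2)
      =ᶠ[𝓝 x] fun x ↦ toCoord p x (Y x) := by
    filter_upwards [(chartAt E p).open_source.mem_nhds hx] with z hz
      using trivializationAt_apply_snd hz _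
  rw [e.mdifferentiableAt_iff, mdifferentiableAt_iff_differentiableAt_comp_symm hx]
  rfl

lemma contMDiffAt_coordField {V : E → E} (hx : x ∈ (chartAt E p).source)
    (hV : ContDiffAt ℝ ∞ V (extChartAt 𝓘(ℝ, E) p x)) : CMDiffAt ∞ (T% (coordField p V)) x := by
  rw [contMDiffAt_section_iff_coordRep hx]
  refine hV.congr_of_eventuallyEq ?_
  filter_upwards [(isOpen_extChartAt_target p).mem_nhds (extChartAt_mem_target hx)] with y hy
    using coordRep_coordField hy V

/-- The equation `hV` retypes `coordRep p Z`, a map E → E, as a section of the tangent bundle of E,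
the form in which `mpullback` and `mlieBracket` take it. -/
lemma mpullback_coordRep {Z : Π x : M, TangentSpace 𝓘(ℝ, E) x}
    (hx : x ∈ (chartAt E p).source) {V : Π y : E, TangentSpace 𝓘(ℝ, E) y}
    (hV : V = coordRep p Z) :
    mpullback 𝓘(ℝ, E) 𝓘(ℝ, E) (extChartAt 𝓘(ℝ, E) p) V x = Z x := by
  have hinv : (mfderiv 𝓘(ℝ, E) 𝓘(ℝ, E) (extChartAt 𝓘(ℝ, E) p) x).IsInvertible :=
    isInvertible_mfderiv_extChartAt (by simpa using hx)
  rw [mpullback_apply, hinv.inverse_apply_eq, hV, ← toCoord_eq_mfderiv hx]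
  exact coordRep_extChartAt hx Z

lemma mdifferentiableAt_vectorField_of_contDiffAt {V : Π y : E, TangentSpace 𝓘(ℝ, E) y}
    {W : E → E} (hVW : V = W) {y : E} (hW : ContDiffAt ℝ ∞ W y) : MDiffAt (T% V) y := by
  subst hVW
  exact (contMDiffAt_vectorSpace_iff_contDiffAt.2 hW).mdifferentiableAt (by simp)

lemma mlieBracket_eq_fderiv {V W : Π y : E, TangentSpace 𝓘(ℝ, E) y} (y : E) :
    mlieBracket 𝓘(ℝ, E) V W y =
      fderiv ℝ (fun y ↦ (W y : E)) y (V y) - fderiv ℝ (fun y ↦ (V y : E)) y (W y) := by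
  rw [← mlieBracketWithin_univ, mlieBracketWithin_eq_lieBracketWithin]
  exact congrFun (lieBracketWithin_univ (𝕜 := ℝ) (E := E) (V := V) (W := W)) y

/-- Near x each field is the pullback of its coordinate representation under the chart, and the
bracket is natural under pullback. -/
lemma toCoord_mlieBracket [CompleteSpace E] {X Y : Π x : M, TangentSpace 𝓘(ℝ, E) x}
    (hx : x ∈ (chartAt E p).source) (hX : CMDiffAt ∞ (T% X) x) (hY : CMDiffAt ∞ (T% Y) x) :
    toCoord p x (mlieBracket 𝓘(ℝ, E) X Y x) =
      fderiv ℝ (coordRep p Y) (extChartAt 𝓘(ℝ, E) p x) (toCoord p x (X x)) -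
      fderiv ℝ (coordRep p X) (extChartAt 𝓘(ℝ, E) p x) (toCoord p x (Y x)) := by
  have : IsManifold 𝓘(ℝ, E) (minSmoothness ℝ 2) M := by
    simpa using IsManifold.of_le (I := 𝓘(ℝ, E)) (M := M) (m := 2) (n := ∞) ENat.LEInfty.out
  obtain ⟨X', hX'⟩ : ∃ V : Π y : E, TangentSpace 𝓘(ℝ, E) y, V = coordRep p X := ⟨_, rfl⟩
  obtain ⟨Y', hY'⟩ : ∃ V : Π y : E, TangentSpace 𝓘(ℝ, E) y, V = coordRep p Y := ⟨_, rfl⟩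
  have hpull {Z : Π x : M, TangentSpace 𝓘(ℝ, E) x} {V : Π y : E, TangentSpace 𝓘(ℝ, E) y}
      (hV : V = coordRep p Z) :
      Z =ᶠ[𝓝 x] mpullback 𝓘(ℝ, E) 𝓘(ℝ, E) (extChartAt 𝓘(ℝ, E) p) V := by
    filter_upwards [(chartAt E p).open_source.mem_nhds hx] with z hz
      using (mpullback_coordRep hz hV).symm
  have hφ : ContMDiffAt 𝓘(ℝ, E) 𝓘(ℝ, E) ∞ (extChartAt 𝓘(ℝ, E) p) x :=
    contMDiffAt_extChartAt' hx
  have hinv : (mfderiv 𝓘(ℝ, E) 𝓘(ℝ, E) (extChartAt 𝓘(ℝ, E) p) x).IsInvertible :=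
    isInvertible_mfderiv_extChartAt (by simpa using hx)
  have key := mpullback_mlieBracket
    (mdifferentiableAt_vectorField_of_contDiffAt hX' ((contMDiffAt_section_iff_coordRep hx).1 hX))
    (mdifferentiableAt_vectorField_of_contDiffAt hY' ((contMDiffAt_section_iff_coordRep hx).1 hY))
    hφ (by simpa using ENat.LEInfty.out)
  rw [mpullback_apply, hinv.inverse_apply_eq, ← toCoord_eq_mfderiv hx, mlieBracket_eq_fderiv]
    at key
  rw [(hpull hX').mlieBracket_vectorField_eq (hpull hY')]
  refine key.symm.trans ?_
  subst hX' hY'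
  rw [← coordRep_extChartAt hx X, ← coordRep_extChartAt hx Y]

end Chart


/-! ### Christoffel symbols of a connection and its curvature in a chart. -/

section Christoffel

set_option maxSynthPendingDepth 3

variable {E : Type*} [NormedAddCommGroup E] [NormedSpace ℝ E]
  {M : Type*} [TopologicalSpace M] [ChartedSpace E M] [IsManifold 𝓘(ℝ, E) ∞ M] {p x : M}

lemma contMDiffAt_homSection_iff {A : Π x : M, TangentSpace 𝓘(ℝ, E) x →L[ℝ] TangentSpace 𝓘(ℝ, E) x}
    (hx : x ∈ (chartAt E p).source) :
    ContMDiffAt 𝓘(ℝ, E) (𝓘(ℝ, E).prod 𝓘(ℝ, E →L[ℝ] E)) ∞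
      (fun x ↦ (TotalSpace.mk' (E →L[ℝ] E) x (A x) : TotalSpace (E →L[ℝ] E)
        (fun x : M ↦ TangentSpace 𝓘(ℝ, E) x →L[ℝ] TangentSpace 𝓘(ℝ, E) x))) x ↔
    ContDiffAt ℝ ∞ (fun y ↦ (toCoord p ((extChartAt 𝓘(ℝ, E) p).symm y)).comp
      ((A ((extChartAt 𝓘(ℝ, E) p).symm y)).comp (ofCoord p ((extChartAt 𝓘(ℝ, E) p).symm y))))
      (extChartAt 𝓘(ℝ, E) p x) := by
  rw [(trivializationAt (E →L[ℝ] E)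
    (fun x : M ↦ TangentSpace 𝓘(ℝ, E) x →L[ℝ] TangentSpace 𝓘(ℝ, E) x)
    p).contMDiffAt_section_iff (by simpa using hx)]
  exact contMDiffAt_iff_contDiffAt_comp_symm hx

lemma contMDiffAt_dualSection_iff {ρ : Π x : M, TangentSpace 𝓘(ℝ, E) x →L[ℝ] ℝ}
    (hx : x ∈ (chartAt E p).source) :
    ContMDiffAt 𝓘(ℝ, E) (𝓘(ℝ, E).prod 𝓘(ℝ, E →L[ℝ] ℝ)) ∞
      (fun x ↦ (TotalSpace.mk' (E →L[ℝ] ℝ) x (ρ x) : TotalSpace (E →L[ℝ] ℝ)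
        (fun x : M ↦ TangentSpace 𝓘(ℝ, E) x →L[ℝ] ℝ))) x ↔
    ContDiffAt ℝ ∞ (fun y ↦ (ρ ((extChartAt 𝓘(ℝ, E) p).symm y)).comp
      (ofCoord p ((extChartAt 𝓘(ℝ, E) p).symm y))) (extChartAt 𝓘(ℝ, E) p x) := by
  rw [(trivializationAt (E →L[ℝ] ℝ) (fun x : M ↦ TangentSpace 𝓘(ℝ, E) x →L[ℝ] ℝ)
    p).contMDiffAt_section_iff (by simpa using hx)]
  have e : (fun z ↦ (trivializationAt (E →L[ℝ] ℝ) (fun x : M ↦ TangentSpace 𝓘(ℝ, E) x →L[ℝ] ℝ) p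
      (TotalSpace.mk' (E →L[ℝ] ℝ) z (ρ z))).2) = fun z ↦ (ρ z).comp (ofCoord p z) := by
    funext z
    ext v
    simp [hom_trivializationAt_apply, ContinuousLinearMap.inCoordinates, ofCoord]
  rw [e]
  exact contMDiffAt_iff_contDiffAt_comp_symm hx

/-- The connection for which the coordinate fields of the chart at `p` are parallel. -/
noncomputable def coordConnection (p : M) (Y : Π x : M, TangentSpace 𝓘(ℝ, E) x) (x : M) :
    TangentSpace 𝓘(ℝ, E) x →L[ℝ] TangentSpace 𝓘(ℝ, E) x :=
  (ofCoord p x).comp ((fderiv ℝ (coordRep p Y) (extChartAt 𝓘(ℝ, E) p x)).comp (toCoord p x))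

/-- This provides a reference connection on the chart domain: the difference of any other connection
with it is tensorial, which is how `christoffel` is defined. -/
lemma isCovariantDerivativeOn_coordConnection :
    IsCovariantDerivativeOn E (coordConnection (E := E) p) (chartAt E p).source where
  add {σ σ' x} hσ hσ' hx := by
    have e : coordRep p (σ + σ') = coordRep p σ + coordRep p σ' := by
      funext y; exact map_add (toCoord p _) _ _
    ext v
    simp only [coordConnection, e, fderiv_add ((mdifferentiableAt_section_iff_coordRep hx).1 hσ)
      ((mdifferentiableAt_section_iff_coordRep hx).1 hσ'), ContinuousLinearMap.comp_apply,
      _root_.add_apply, map_add]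
  leibniz {σ g x} hσ hg hx := by
    have e : coordRep p (g • σ) = (g ∘ (extChartAt 𝓘(ℝ, E) p).symm) • coordRep p σ := by
      funext y; exact map_smul (toCoord p _) _ _
    ext v
    simp only [coordConnection, e, fderiv_smul
      ((mdifferentiableAt_iff_differentiableAt_comp_symm hx).1 hg)
      ((mdifferentiableAt_section_iff_coordRep hx).1 hσ), ContinuousLinearMap.comp_apply,
      _root_.add_apply, _root_.smul_apply, map_add, map_smul, ContinuousLinearMap.smulRight_apply,
      mvfderiv_eq_fderiv hx hg, coordRep_extChartAt hx, ofCoord_toCoord hx, Function.comp,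
      extChartAt_symm_apply hx]

variable {cov : CovariantDerivative 𝓘(ℝ, E) E (TangentSpace 𝓘(ℝ, E) : M → Type _)}
  {Y : Π x : M, TangentSpace 𝓘(ℝ, E) x}

lemma eventually_mdifferentiableAt (hx : x ∈ (chartAt E p).source) (hY : CMDiffAt ∞ (T% Y) x) :
    ∀ᶠ y in 𝓝 (extChartAt 𝓘(ℝ, E) p x), MDiffAt (T% Y) ((extChartAt 𝓘(ℝ, E) p).symm y) := by
  have h := (contMDiffAt_section_iff_coordRep hx).1 hY
  filter_upwards [(h.of_le (m := 1) (by simp)).eventually (by simp),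
    (isOpen_extChartAt_target p).mem_nhds (extChartAt_mem_target hx)] with y hy hyt
  rw [mdifferentiableAt_section_iff_coordRep (extChartAt_symm_mem hyt),
    (extChartAt 𝓘(ℝ, E) p).right_inv hyt]
  exact hy.differentiableAt (by simp)

lemma contMDiffOn_coordField_const (w : E) :
    CMDiff[(chartAt E p).source] ∞ (T% (coordField (M := M) p fun _ ↦ w)) := fun _ hx ↦
  (contMDiffAt_coordField hx contDiffAt_const).contMDiffWithinAt

lemma cov_congr {Y' : Π x : M, TangentSpace 𝓘(ℝ, E) x} (hY : CMDiffAt ∞ (T% Y) x)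
    (hY' : CMDiffAt ∞ (T% Y') x) (h : ∀ᶠ z in 𝓝 x, Y' z = Y z) : cov Y' x = cov Y x :=
  (cov.isCovariantDerivativeOn (s := univ)).congr_of_eventuallyEq
    (hY'.mdifferentiableAt (by simp)) (hY.mdifferentiableAt (by simp)) Filter.univ_mem h

/-- Tensoriality of curvature: second derivatives of Z cancel by symmetry, first derivatives of X
and Y cancel against the bracket, and first derivatives of Z pair off. -/
lemma christoffelCurvature_eq {Γ : E → E →L[ℝ] E →L[ℝ] E} {X Y Z : E → E} {y : E}
    (hX : DifferentiableAt ℝ X y) (hY : DifferentiableAt ℝ Y y) (hZ : ContDiffAt ℝ ∞ Z y)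
    (hΓ : DifferentiableAt ℝ Γ y) :
    (fderiv ℝ (fun y ↦ fderiv ℝ Z y (Y y) + Γ y (Z y) (Y y)) y (X y)
        + Γ y (fderiv ℝ Z y (Y y) + Γ y (Z y) (Y y)) (X y))
      - (fderiv ℝ (fun y ↦ fderiv ℝ Z y (X y) + Γ y (Z y) (X y)) y (Y y)
        + Γ y (fderiv ℝ Z y (X y) + Γ y (Z y) (X y)) (Y y))
      - (fderiv ℝ Z y (fderiv ℝ Y y (X y) - fderiv ℝ X y (Y y))
        + Γ y (Z y) (fderiv ℝ Y y (X y) - fderiv ℝ X y (Y y)))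
      = christoffelCurvature Γ y (X y) (Y y) (Z y) := by
  have hZ' : DifferentiableAt ℝ (fderiv ℝ Z) y :=
    (hZ.fderiv_right (m := ∞) le_rfl).differentiableAt (by simp)
  have hZ1 : DifferentiableAt ℝ Z y := hZ.differentiableAt (by simp)
  have key : ∀ {Y : E → E}, DifferentiableAt ℝ Y y → ∀ v,
      fderiv ℝ (fun y ↦ fderiv ℝ Z y (Y y) + Γ y (Z y) (Y y)) y v =
        fderiv ℝ (fderiv ℝ Z) y v (Y y) + fderiv ℝ Z y (fderiv ℝ Y y v)
        + (fderiv ℝ Γ y v (Z y) (Y y) + Γ y (fderiv ℝ Z y v) (Y y)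
          + Γ y (Z y) (fderiv ℝ Y y v)) := by
    intro Y hY v
    rw [fderiv_fun_add (hZ'.clm_apply hY) ((hΓ.clm_apply hZ1).clm_apply hY), _root_.add_apply,
      fderiv_lin_apply hZ' hY, fderiv_bilin_apply hΓ hZ1 hY]
  have hs := (hZ.isSymmSndFDerivAt (by simpa using ENat.LEInfty.out)) (X y) (Y y)
  rw [key hX, key hY, hs]
  simp only [christoffelCurvature, map_add, map_sub, _root_.add_apply]
  abel

variable [FiniteDimensional ℝ E]

/-- The Christoffel symbols of a connection in the chart at `p`. -/
noncomputable def christoffel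
    (cov : CovariantDerivative 𝓘(ℝ, E) E (TangentSpace 𝓘(ℝ, E) : M → Type _)) (p : M) (y : E) :
    E →L[ℝ] E →L[ℝ] E :=
  LinearMap.toContinuousLinearMap
    { toFun := fun w ↦ (toCoord p ((extChartAt 𝓘(ℝ, E) p).symm y)).comp
        (((cov.isCovariantDerivativeOn (s := (chartAt E p).source)).difference
          isCovariantDerivativeOn_coordConnection ((extChartAt 𝓘(ℝ, E) p).symm y)
          (ofCoord p ((extChartAt 𝓘(ℝ, E) p).symm y) w)).comp
        (ofCoord p ((extChartAt 𝓘(ℝ, E) p).symm y)))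
      map_add' := fun a b ↦ by
        ext u
        simp only [map_add, ContinuousLinearMap.comp_apply, _root_.add_apply]
      map_smul' := fun c a ↦ by
        ext u
        simp only [map_smul, ContinuousLinearMap.comp_apply, _root_.smul_apply, RingHom.id_apply] }

lemma toCoord_cov (hx : x ∈ (chartAt E p).source) (hY : MDiffAt (T% Y) x)
    (v : TangentSpace 𝓘(ℝ, E) x) :
    toCoord p x (cov Y x v) =
      fderiv ℝ (coordRep p Y) (extChartAt 𝓘(ℝ, E) p x) (toCoord p x v) +
      christoffel cov p (extChartAt 𝓘(ℝ, E) p x) (toCoord p x (Y x)) (toCoord p x v) := by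
  have h : christoffel cov p (extChartAt 𝓘(ℝ, E) p x) (toCoord p x (Y x)) (toCoord p x v) =
      toCoord p x ((cov.isCovariantDerivativeOn (s := (chartAt E p).source)).difference
          isCovariantDerivativeOn_coordConnection x (Y x) v) := by
    simp only [christoffel, LinearMap.coe_toContinuousLinearMap', LinearMap.coe_mk, AddHom.coe_mk,
      ContinuousLinearMap.comp_apply]
    rw [extChartAt_symm_apply hx, ofCoord_toCoord hx, ofCoord_toCoord hx]
  rw [h, IsCovariantDerivativeOn.difference_apply _ _ hx hY]
  simp [coordConnection, toCoord_ofCoord hx]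

lemma christoffel_apply (hx : x ∈ (chartAt E p).source) (w u : E) :
    christoffel cov p (extChartAt 𝓘(ℝ, E) p x) w u =
      toCoord p x (cov (coordField p fun _ ↦ w) x (ofCoord p x u)) := by
  have hs : CMDiffAt ∞ (T% (coordField (M := M) p fun _ ↦ w)) x :=
    contMDiffAt_coordField hx contDiffAt_const
  have hf : coordRep (M := M) p (coordField p fun _ ↦ w)
      =ᶠ[𝓝 (extChartAt 𝓘(ℝ, E) p x)] fun _ ↦ w := by
    filter_upwards [(isOpen_extChartAt_target p).mem_nhds (extChartAt_mem_target hx)] with y hy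
      using coordRep_coordField hy _
  rw [toCoord_cov hx (hs.mdifferentiableAt (by simp)), hf.fderiv_eq, toCoord_ofCoord hx,
    coordField, toCoord_ofCoord hx]
  simp

lemma coordRep_cov {Z : Π x : M, TangentSpace 𝓘(ℝ, E) x} (hx : x ∈ (chartAt E p).source)
    (hZ : CMDiffAt ∞ (T% Z) x) :
    coordRep p (fun z ↦ cov Z z (Y z)) =ᶠ[𝓝 (extChartAt 𝓘(ℝ, E) p x)] fun y ↦
      fderiv ℝ (coordRep p Z) y (coordRep p Y y) +
        christoffel cov p y (coordRep p Z y) (coordRep p Y y) := by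
  filter_upwards [eventually_mdifferentiableAt hx hZ,
    (isOpen_extChartAt_target p).mem_nhds (extChartAt_mem_target hx)] with y hy hyt
  have h := toCoord_cov (cov := cov) (extChartAt_symm_mem hyt) hy
    (Y ((extChartAt 𝓘(ℝ, E) p).symm y))
  rw [(extChartAt 𝓘(ℝ, E) p).right_inv hyt] at h
  exact h

lemma contMDiffAt_cov (hx : x ∈ (chartAt E p).source)
    (hΓ : ContDiffAt ℝ ∞ (christoffel cov p) (extChartAt 𝓘(ℝ, E) p x))
    (hY : CMDiffAt ∞ (T% Y) x) :
    ContMDiffAt 𝓘(ℝ, E) (𝓘(ℝ, E).prod 𝓘(ℝ, E →L[ℝ] E)) ∞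
      (fun x ↦ (TotalSpace.mk' (E →L[ℝ] E) x (cov Y x) : TotalSpace (E →L[ℝ] E)
        (fun x : M ↦ TangentSpace 𝓘(ℝ, E) x →L[ℝ] TangentSpace 𝓘(ℝ, E) x))) x := by
  rw [contMDiffAt_homSection_iff hx]
  have h := (contMDiffAt_section_iff_coordRep hx).1 hY
  refine ((h.fderiv_right (m := ∞) le_rfl).add (hΓ.clm_apply h)).congr_of_eventuallyEq ?_
  filter_upwards [eventually_mdifferentiableAt hx hY,
    (isOpen_extChartAt_target p).mem_nhds (extChartAt_mem_target hx)] with y hy hyt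
  ext v
  have h := toCoord_cov (cov := cov) (extChartAt_symm_mem hyt) hy
    (ofCoord p ((extChartAt 𝓘(ℝ, E) p).symm y) v)
  rw [(extChartAt 𝓘(ℝ, E) p).right_inv hyt, toCoord_ofCoord (extChartAt_symm_mem hyt)] at h
  exact h

/-- Multiplication by a bump function supported in U. Smoothness of `cov` and conjugate symmetry are
tested only on globally smooth fields, while coordinate fields are smooth only over a chart. -/
lemma exists_contMDiff_eventuallyEq [T2Space M] {U : Set M} (hU : IsOpen U) (hx : x ∈ U)
    (hY : CMDiff[U] ∞ (T% Y)) :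
    ∃ Y' : Π x : M, TangentSpace 𝓘(ℝ, E) x, CMDiff ∞ (T% Y') ∧ ∀ᶠ z in 𝓝 x, Y' z = Y z := by
  obtain ⟨f, -, hf⟩ :=
    (SmoothBumpFunction.nhds_basis_tsupport (I := 𝓘(ℝ, E)) x).mem_iff.1 (hU.mem_nhds hx)
  refine ⟨(f : M → ℝ) • Y,
    ContMDiffOn.smul_section_of_tsupport f.contMDiff.contMDiffOn hU hf hY, ?_⟩
  filter_upwards [f.eventuallyEq_one] with z hz
  simp [hz]

lemma contDiffOn_christoffel [T2Space M]
    (hcov : CovariantDerivative.ContMDiffCovariantDerivative cov ∞) :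
    ContDiffOn ℝ ∞ (christoffel cov p) (extChartAt 𝓘(ℝ, E) p).target := by
  rw [contDiffOn_bilin_iff]
  intro w u y hy
  obtain ⟨x, hx, rfl⟩ : ∃ x ∈ (chartAt E p).source, extChartAt 𝓘(ℝ, E) p x = y :=
    ⟨_, extChartAt_symm_mem hy, (extChartAt 𝓘(ℝ, E) p).right_inv hy⟩
  obtain ⟨Y, hY, hYe⟩ := exists_contMDiff_eventuallyEq (chartAt E p).open_source hx
    (contMDiffOn_coordField_const w)
  have h1 := (hcov.contMDiff.contMDiff (σ := Y) hY.contMDiffOn).contMDiffAt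
    (Filter.univ_mem (f := 𝓝 x))
  have h2 := h1.clm_bundle_apply
    ((contMDiffOn_coordField_const u).contMDiffAt ((chartAt E p).open_source.mem_nhds hx))
  refine ((contMDiffAt_section_iff_coordRep hx).1 h2).congr_of_eventuallyEq ?_
    |>.contDiffWithinAt
  have hc : Filter.Tendsto (extChartAt 𝓘(ℝ, E) p).symm (𝓝 (extChartAt 𝓘(ℝ, E) p x)) (𝓝 x) := by
    have := continuousAt_extChartAt_symm' (I := 𝓘(ℝ, E)) (x := p) (x' := x) (by simpa using hx)
    rwa [ContinuousAt, extChartAt_symm_apply hx] at this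
  filter_upwards [(isOpen_extChartAt_target p).mem_nhds (extChartAt_mem_target hx),
    hc.eventually hYe.eventually_nhds] with y hy hye
  have hz := extChartAt_symm_mem hy
  have h3 := christoffel_apply (cov := cov) hz w u
  rw [(extChartAt 𝓘(ℝ, E) p).right_inv hy] at h3
  rw [h3, ← cov_congr (contMDiffAt_coordField hz contDiffAt_const) hY.contMDiffAt hye]
  simp only [coordRep, coordField]

/-- Smoothness is asked only of the Christoffel symbols near the point, so that this applies to a
projective change whose 1-form is smooth only on an open set. -/
lemma toCoord_curvature {X Y Z : Π x : M, TangentSpace 𝓘(ℝ, E) x}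
    (hx : x ∈ (chartAt E p).source)
    (hΓ : ContDiffAt ℝ ∞ (christoffel cov p) (extChartAt 𝓘(ℝ, E) p x))
    (hX : CMDiffAt ∞ (T% X) x) (hY : CMDiffAt ∞ (T% Y) x) (hZ : CMDiffAt ∞ (T% Z) x) :
    toCoord p x (curvature cov.toFun X Y Z x) =
      christoffelCurvature (christoffel cov p) (extChartAt 𝓘(ℝ, E) p x)
        (toCoord p x (X x)) (toCoord p x (Y x)) (toCoord p x (Z x)) := by
  have := FiniteDimensional.complete ℝ E
  have hd : ∀ {X : Π x : M, TangentSpace 𝓘(ℝ, E) x}, CMDiffAt ∞ (T% X) x →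
      ContDiffAt ℝ ∞ (coordRep p X) (extChartAt 𝓘(ℝ, E) p x) := fun h ↦
    (contMDiffAt_section_iff_coordRep hx).1 h
  have hZm : MDiffAt (T% Z) x := hZ.mdifferentiableAt (by simp)
  have hF : ∀ {Y : Π x : M, TangentSpace 𝓘(ℝ, E) x}, CMDiffAt ∞ (T% Y) x → ∀ v,
      toCoord p x (cov (fun y ↦ cov Z y (Y y)) x v) =
        fderiv ℝ (fun y ↦ fderiv ℝ (coordRep p Z) y (coordRep p Y y) +
          christoffel cov p y (coordRep p Z y) (coordRep p Y y)) (extChartAt 𝓘(ℝ, E) p x)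
          (toCoord p x v) +
        christoffel cov p (extChartAt 𝓘(ℝ, E) p x)
          (fderiv ℝ (coordRep p Z) (extChartAt 𝓘(ℝ, E) p x) (toCoord p x (Y x)) +
            christoffel cov p (extChartAt 𝓘(ℝ, E) p x) (toCoord p x (Z x)) (toCoord p x (Y x)))
          (toCoord p x v) := by
    intro Y hY v
    have h : CMDiffAt ∞ (T% (fun y ↦ cov Z y (Y y))) x :=
      (contMDiffAt_cov hx hΓ hZ).clm_bundle_apply hY
    rw [toCoord_cov hx (h.mdifferentiableAt (by simp)), (coordRep_cov hx hZ).fderiv_eq,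
      toCoord_cov hx hZm]
  rw [curvature, map_sub, map_sub, hF hX, hF hY, toCoord_cov hx hZm, toCoord_mlieBracket hx hX hY]
  simp only [← coordRep_extChartAt hx]
  exact christoffelCurvature_eq ((hd hX).differentiableAt (by simp))
    ((hd hY).differentiableAt (by simp)) (hd hZ) (hΓ.differentiableAt (by simp))

end Christoffel


/-! ### Projective flatness as a coordinate condition. -/

lemma christoffelCurvature_congr {E : Type*} [NormedAddCommGroup E] [NormedSpace ℝ E]
    {Γ Γ' : E → E →L[ℝ] E →L[ℝ] E} {y : E} (h : Γ =ᶠ[𝓝 y] Γ') (u v w : E) :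
    christoffelCurvature Γ y u v w = christoffelCurvature Γ' y u v w := by
  simp only [christoffelCurvature, h.fderiv_eq, h.eq_of_nhds]

section ProjectiveChange

set_option maxSynthPendingDepth 3

variable {E : Type*} [NormedAddCommGroup E] [NormedSpace ℝ E] [FiniteDimensional ℝ E]
  {M : Type*} [TopologicalSpace M] [ChartedSpace E M] [IsManifold 𝓘(ℝ, E) ∞ M] {p x : M}
  {cov : CovariantDerivative 𝓘(ℝ, E) E (TangentSpace 𝓘(ℝ, E) : M → Type _)}

/-- The bilinear map `(w, u) ↦ α(u) w + α(w) u` on a tangent space. -/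
noncomputable def symmProdTangent (x : M) (α : TangentSpace 𝓘(ℝ, E) x →L[ℝ] ℝ) :
    TangentSpace 𝓘(ℝ, E) x →L[ℝ] TangentSpace 𝓘(ℝ, E) x →L[ℝ] TangentSpace 𝓘(ℝ, E) x :=
  haveI : FiniteDimensional ℝ (TangentSpace 𝓘(ℝ, E) x) := inferInstanceAs (FiniteDimensional ℝ E)
  haveI : T2Space (TangentSpace 𝓘(ℝ, E) x) := inferInstanceAs (T2Space E)
  LinearMap.toContinuousLinearMap
    { toFun := fun w ↦ α.smulRight w + α w • ContinuousLinearMap.id ℝ _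
      map_add' := fun a b ↦ by
        ext u
        simp only [_root_.add_apply, _root_.smul_apply, ContinuousLinearMap.smulRight_apply,
          map_add]
        module
      map_smul' := fun c a ↦ by
        ext u
        simp only [_root_.add_apply, _root_.smul_apply, ContinuousLinearMap.smulRight_apply,
          map_smul, RingHom.id_apply, smul_eq_mul]
        module }

/-- The projective change of a connection by a 1-form. -/
noncomputable def projectiveCov
    (cov : CovariantDerivative 𝓘(ℝ, E) E (TangentSpace 𝓘(ℝ, E) : M → Type _))
    (ρ : Π x : M, TangentSpace 𝓘(ℝ, E) x →L[ℝ] ℝ) :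
    CovariantDerivative 𝓘(ℝ, E) E (TangentSpace 𝓘(ℝ, E) : M → Type _) :=
  cov.addOneForm fun x ↦ symmProdTangent x (ρ x)

lemma projectiveCov_apply (ρ : Π x : M, TangentSpace 𝓘(ℝ, E) x →L[ℝ] ℝ)
    (Y : Π x : M, TangentSpace 𝓘(ℝ, E) x) (v : TangentSpace 𝓘(ℝ, E) x) :
    projectiveCov cov ρ Y x v = cov Y x v + ρ x v • Y x + ρ x (Y x) • v :=
  (add_assoc _ _ _).symm

lemma christoffel_projectiveCov (ρ : Π x : M, TangentSpace 𝓘(ℝ, E) x →L[ℝ] ℝ)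
    (hx : x ∈ (chartAt E p).source) {ρ' : E → E →L[ℝ] ℝ}
    (hρ : ∀ a, ρ' (extChartAt 𝓘(ℝ, E) p x) a = ρ x (ofCoord p x a)) :
    christoffel (projectiveCov cov ρ) p (extChartAt 𝓘(ℝ, E) p x) =
      projectiveChange (christoffel cov p) ρ' (extChartAt 𝓘(ℝ, E) p x) := by
  ext a u
  rw [christoffel_apply hx, projectiveCov_apply, projectiveChange_apply, christoffel_apply hx,
    hρ, hρ]
  simp only [map_add, map_smul, coordField, toCoord_ofCoord hx]
  abel

/-- The formula for D is known only on fields smooth over U. Smoothness of D makes the inner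
derivative such a field, so the formula applies twice, and locality of `projectiveCov` absorbs the
discrepancy outside U. -/
lemma curvature_eq_curvature_projectiveCov {U : Set M} (hU : IsOpen U) (hx : x ∈ U)
    {D : (Π x : M, TangentSpace 𝓘(ℝ, E) x) →
      (Π x : M, TangentSpace 𝓘(ℝ, E) x →L[ℝ] TangentSpace 𝓘(ℝ, E) x)}
    (hD : ContMDiffCovariantDerivativeOn E ∞ D U)
    {ρ : Π x : M, TangentSpace 𝓘(ℝ, E) x →L[ℝ] ℝ}
    (hρ : ∀ Y : (Π x : M, TangentSpace 𝓘(ℝ, E) x), CMDiff[U] ∞ (T% Y) → ∀ x ∈ U,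
      ∀ v : TangentSpace 𝓘(ℝ, E) x, D Y x v = cov Y x v + ρ x v • Y x + ρ x (Y x) • v)
    {X Y Z : Π x : M, TangentSpace 𝓘(ℝ, E) x} (hX : CMDiff[U] ∞ (T% X))
    (hY : CMDiff[U] ∞ (T% Y)) (hZ : CMDiff[U] ∞ (T% Z)) :
    curvature D X Y Z x = curvature (projectiveCov cov ρ).toFun X Y Z x := by
  have hDρ {Y : Π x : M, TangentSpace 𝓘(ℝ, E) x} (hY : CMDiff[U] ∞ (T% Y)) {x : M} (hx : x ∈ U)
      (v : TangentSpace 𝓘(ℝ, E) x) : D Y x v = projectiveCov cov ρ Y x v := by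
    rw [hρ Y hY x hx, projectiveCov_apply]
  have key {Y : Π x : M, TangentSpace 𝓘(ℝ, E) x} (hY : CMDiff[U] ∞ (T% Y))
      (v : TangentSpace 𝓘(ℝ, E) x) : D (fun y ↦ D Z y (Y y)) x v =
        projectiveCov cov ρ (fun y ↦ projectiveCov cov ρ Z y (Y y)) x v := by
    have hF : CMDiff[U] ∞ (T% (fun y ↦ D Z y (Y y))) :=
      (hD.contMDiff (σ := Z) hZ).clm_bundle_apply hY
    have he : ∀ᶠ z in 𝓝 x, projectiveCov cov ρ Z z (Y z) = D Z z (Y z) := by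
      filter_upwards [hU.mem_nhds hx] with z hz using (hDρ hZ hz _).symm
    have hFx := hF.contMDiffAt (hU.mem_nhds hx)
    have hFx' : CMDiffAt ∞ (T% (fun y ↦ projectiveCov cov ρ Z y (Y y))) x := by
      refine hFx.congr_of_eventuallyEq ?_
      filter_upwards [he] with z hz
      rw [hz]
    rw [hDρ hF hx, cov_congr hFx hFx' he]
  rw [curvature, curvature, key hX, key hY, hDρ hZ hx]

lemma exists_contMDiff_toCoord_eq [T2Space M] (hx : x ∈ (chartAt E p).source) (w : E) :
    ∃ Y : Π x : M, TangentSpace 𝓘(ℝ, E) x, CMDiff ∞ (T% Y) ∧ toCoord p x (Y x) = w := by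
  obtain ⟨Y, hY, hYe⟩ := exists_contMDiff_eventuallyEq (chartAt E p).open_source hx
    (contMDiffOn_coordField_const w)
  exact ⟨Y, hY, by rw [hYe.self_of_nhds, coordField, toCoord_ofCoord hx]⟩

lemma torsion_eq_zero_apply (h : cov.torsion = 0) {X Y : Π x : M, TangentSpace 𝓘(ℝ, E) x}
    (hX : CMDiffAt ∞ (T% X) x) (hY : CMDiffAt ∞ (T% Y) x) :
    cov Y x (X x) - cov X x (Y x) - mlieBracket 𝓘(ℝ, E) X Y x = 0 := by
  have := FiniteDimensional.complete ℝ E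
  have h1 := cov.torsion_apply (hX.mdifferentiableAt (by simp)) (hY.mdifferentiableAt (by simp))
  rw [h] at h1
  exact h1.symm

/-- Any flat D in the definition agrees over U with `projectiveCov cov ρ`, whose symbols are the
projective change of those of `cov`. Conversely, a coordinate 1-form is pulled back through the
chart; its values away from W play no role. -/
theorem isProjectivelyFlat_iff [T2Space M] (htors : cov.torsion = 0)
    (hΓ : ∀ p : M, ContDiffOn ℝ ∞ (christoffel cov p) (extChartAt 𝓘(ℝ, E) p).target) :
    IsProjectivelyFlat cov ↔ ∀ p : M, ∃ W : Set E, IsOpen W ∧ extChartAt 𝓘(ℝ, E) p p ∈ W ∧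
      W ⊆ (extChartAt 𝓘(ℝ, E) p).target ∧ ∃ ρ : E → E →L[ℝ] ℝ, ContDiffOn ℝ ∞ ρ W ∧
      ∀ y ∈ W, ∀ u v w, christoffelCurvature (projectiveChange (christoffel cov p) ρ) y u v w = 0 := by
  constructor
  · intro h p
    obtain ⟨U, hU, hpU, D, hD, ρ, hρ, hDρ⟩ := h p
    have hsrc : ∀ y ∈ (extChartAt 𝓘(ℝ, E) p).target ∩ (extChartAt 𝓘(ℝ, E) p).symm ⁻¹' U,
        ∃ x ∈ (chartAt E p).source ∩ U, extChartAt 𝓘(ℝ, E) p x = y := fun y hy ↦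
      ⟨_, ⟨extChartAt_symm_mem hy.1, hy.2⟩, (extChartAt 𝓘(ℝ, E) p).right_inv hy.1⟩
    have hW : IsOpen ((extChartAt 𝓘(ℝ, E) p).target ∩ (extChartAt 𝓘(ℝ, E) p).symm ⁻¹' U) :=
      (continuousOn_extChartAt_symm p).isOpen_inter_preimage (isOpen_extChartAt_target p) hU
    have hρW : ContDiffOn ℝ ∞ (fun y ↦ (ρ ((extChartAt 𝓘(ℝ, E) p).symm y)).comp
        (ofCoord p ((extChartAt 𝓘(ℝ, E) p).symm y)))
        ((extChartAt 𝓘(ℝ, E) p).target ∩ (extChartAt 𝓘(ℝ, E) p).symm ⁻¹' U) := by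
      intro y hy
      obtain ⟨x, hx, rfl⟩ := hsrc y hy
      exact ((contMDiffAt_dualSection_iff hx.1).1
        (hρ.contMDiffAt (hU.mem_nhds hx.2))).contDiffWithinAt
    refine ⟨_, hW, ⟨mem_extChartAt_target p, by simpa using hpU⟩, inter_subset_left,
      fun y ↦ (ρ ((extChartAt 𝓘(ℝ, E) p).symm y)).comp
        (ofCoord p ((extChartAt 𝓘(ℝ, E) p).symm y)), hρW, ?_⟩
    · intro y hy u v w
      have he : projectiveChange (christoffel cov p) (fun y ↦
          (ρ ((extChartAt 𝓘(ℝ, E) p).symm y)).comp (ofCoord p ((extChartAt 𝓘(ℝ, E) p).symm y)))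
          =ᶠ[𝓝 y] christoffel (projectiveCov cov ρ) p := by
        filter_upwards [hW.mem_nhds hy] with z hz
        obtain ⟨x, hx, rfl⟩ := hsrc z hz
        refine (christoffel_projectiveCov ρ hx.1 fun a ↦ ?_).symm
        simp only [ContinuousLinearMap.comp_apply]
        rw [extChartAt_symm_apply hx.1]
      have hρ : ContDiffAt ℝ ∞ (christoffel (projectiveCov cov ρ) p) y := by
        refine ContDiffAt.congr_of_eventuallyEq ?_ he.symm
        exact (contDiffOn_projectiveChange ((hΓ p).mono inter_subset_left) hρW).contDiffAt
          (hW.mem_nhds hy)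
      rw [christoffelCurvature_congr he]
      obtain ⟨x, hx, rfl⟩ := hsrc y hy
      obtain ⟨X, hX, rfl⟩ := exists_contMDiff_toCoord_eq hx.1 u
      obtain ⟨Y, hY, rfl⟩ := exists_contMDiff_toCoord_eq hx.1 v
      obtain ⟨Z, hZ, rfl⟩ := exists_contMDiff_toCoord_eq hx.1 w
      rw [← toCoord_curvature hx.1 hρ hX.contMDiffAt hY.contMDiffAt hZ.contMDiffAt,
        ← curvature_eq_curvature_projectiveCov hU hx.2 hD.smooth hDρ hX.contMDiffOn
          hY.contMDiffOn hZ.contMDiffOn,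
        hD.curvature_eq_zero X Y Z hX.contMDiffOn hY.contMDiffOn hZ.contMDiffOn x hx.2, map_zero]
  · intro h p
    obtain ⟨W, hW, hpW, hWt, ρ, hρ, hR⟩ := h p
    have hU : IsOpen ((chartAt E p).source ∩ extChartAt 𝓘(ℝ, E) p ⁻¹' W) := by
      have := (continuousOn_extChartAt (I := 𝓘(ℝ, E)) p).isOpen_inter_preimage
        (isOpen_extChartAt_source p) hW
      rwa [extChartAt_source] at this
    set ρ' : Π x : M, TangentSpace 𝓘(ℝ, E) x →L[ℝ] ℝ :=
      fun x ↦ (ρ (extChartAt 𝓘(ℝ, E) p x)).comp (toCoord p x) with hρ'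
    have he : ∀ y ∈ W, christoffel (projectiveCov cov ρ') p y =
        projectiveChange (christoffel cov p) ρ y := by
      intro y hy
      have hx := extChartAt_symm_mem (hWt hy)
      have h1 := christoffel_projectiveCov (cov := cov) ρ' hx (ρ' := ρ) fun a ↦ by
        simp only [hρ', ContinuousLinearMap.comp_apply]
        rw [toCoord_ofCoord hx]
      rwa [(extChartAt 𝓘(ℝ, E) p).right_inv (hWt hy)] at h1
    have he' : ∀ y ∈ W, christoffel (projectiveCov cov ρ') p =ᶠ[𝓝 y]
        projectiveChange (christoffel cov p) ρ := fun y hy ↦ by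
      filter_upwards [hW.mem_nhds hy] with z hz using he z hz
    have hΓ0 : ∀ y ∈ W, ContDiffAt ℝ ∞ (christoffel (projectiveCov cov ρ') p) y := fun y hy ↦
      ((contDiffOn_projectiveChange ((hΓ p).mono hWt) hρ).contDiffAt
        (hW.mem_nhds hy)).congr_of_eventuallyEq (he' y hy)
    refine ⟨_, hU, ⟨mem_chart_source E p, hpW⟩, (projectiveCov cov ρ').toFun,
      ⟨(projectiveCov cov ρ').isCovariantDerivativeOn, ⟨fun {σ} hσ x hx ↦ ?_⟩,
        fun X Y hX hY x hx ↦ ?_, fun X Y Z hX hY hZ x hx ↦ ?_⟩, ρ', fun x hx ↦ ?_,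
      fun Y hY x hx v ↦ projectiveCov_apply ρ' Y v⟩
    · exact (contMDiffAt_cov hx.1 (hΓ0 _ hx.2)
        (hσ.contMDiffAt (hU.mem_nhds hx))).contMDiffWithinAt
    -- The correction by ρ is symmetric in X and Y, so it leaves the torsion unchanged.
    · have := torsion_eq_zero_apply htors (hX.contMDiffAt (hU.mem_nhds hx))
        (hY.contMDiffAt (hU.mem_nhds hx))
      rw [projectiveCov_apply, projectiveCov_apply, ← this]
      abel
    · refine toCoord_injective hx.1 ?_
      rw [toCoord_curvature hx.1 (hΓ0 _ hx.2) (hX.contMDiffAt (hU.mem_nhds hx))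
        (hY.contMDiffAt (hU.mem_nhds hx)) (hZ.contMDiffAt (hU.mem_nhds hx)),
        christoffelCurvature_congr (he' _ hx.2), hR _ hx.2, map_zero]
    · refine ((contMDiffAt_dualSection_iff hx.1).2 ?_).contMDiffWithinAt
      refine (hρ.contDiffAt (hW.mem_nhds hx.2)).congr_of_eventuallyEq ?_
      filter_upwards [hW.mem_nhds hx.2] with y hy
      ext a
      have hz := extChartAt_symm_mem (hWt hy)
      simp only [hρ', ContinuousLinearMap.comp_apply]
      rw [toCoord_ofCoord hz, (extChartAt 𝓘(ℝ, E) p).right_inv (hWt hy)]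

end ProjectiveChange


/-! ### Recovering smoothness by raising an index. -/

section Nondegenerate

set_option maxSynthPendingDepth 3

variable {E : Type*} [NormedAddCommGroup E] [NormedSpace ℝ E] [FiniteDimensional ℝ E]

lemma isInvertible_of_pos {g : E →L[ℝ] E →L[ℝ] ℝ} (hg : ∀ a, a ≠ 0 → 0 < g a a) :
    g.IsInvertible := by
  have hinj : Function.Injective (g : E →ₗ[ℝ] E →L[ℝ] ℝ) := by
    rw [← LinearMap.ker_eq_bot, LinearMap.ker_eq_bot']
    intro a ha
    by_contra h
    have h1 := hg a h
    have h2 : g a a = 0 := by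
      have h3 : g a = 0 := ha
      rw [h3]; rfl
    exact h1.ne' h2
  have hdim : Module.finrank ℝ E = Module.finrank ℝ (E →L[ℝ] ℝ) := by
    rw [← (LinearMap.toContinuousLinearMap : (E →ₗ[ℝ] ℝ) ≃ₗ[ℝ] (E →L[ℝ] ℝ)).finrank_eq]
    exact (Subspace.dual_finrank_eq (K := ℝ) (V := E)).symm
  exact ⟨(LinearEquiv.ofInjectiveOfFinrankEq _ hinj hdim).toContinuousLinearEquiv, by ext; rfl⟩

/-- X is the inverse of g applied to g(X, ·), and inversion is smooth at invertible maps. -/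
lemma contDiffOn_of_contDiffOn_metric_apply {F : Type*} [NormedAddCommGroup F] [NormedSpace ℝ F]
    {g : F → E →L[ℝ] E →L[ℝ] ℝ} {V : Set F}
    (hg : ContDiffOn ℝ ∞ g V) (hpos : ∀ y ∈ V, ∀ a, a ≠ 0 → 0 < g y a a) {X : F → E}
    (hX : ∀ a, ContDiffOn ℝ ∞ (fun y ↦ g y (X y) a) V) : ContDiffOn ℝ ∞ X V := by
  have hgX : ContDiffOn ℝ ∞ (fun y ↦ g y (X y)) V := contDiffOn_clm_apply.2 hX
  have hinv : ContDiffOn ℝ ∞ (fun y ↦ (g y).inverse) V := by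
    intro y hy
    obtain ⟨e, he⟩ := isInvertible_of_pos (hpos y hy)
    exact (he ▸ contDiffAt_map_inverse e).comp_contDiffWithinAt y (hg y hy)
  refine (hinv.clm_apply hgX).congr fun y hy ↦ ?_
  exact ((isInvertible_of_pos (hpos y hy)).inverse_apply_eq.2 rfl).symm

end Nondegenerate

/-! ### The dual connection in coordinates and the conclusion. -/

section Dual

set_option maxSynthPendingDepth 3

variable {E : Type*} [NormedAddCommGroup E] [NormedSpace ℝ E]
  {M : Type*} [TopologicalSpace M] [ChartedSpace E M] [IsManifold 𝓘(ℝ, E) ∞ M] {p x : M}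

lemma contMDiffAt_inner_coordField [RiemannianBundle (fun x : M ↦ TangentSpace 𝓘(ℝ, E) x)]
    [IsContMDiffRiemannianBundle 𝓘(ℝ, E) ∞ E (fun x : M ↦ TangentSpace 𝓘(ℝ, E) x)]
    (hx : x ∈ (chartAt E p).source) (a b : E) :
    ContMDiffAt 𝓘(ℝ, E) 𝓘(ℝ, ℝ) ∞ (fun z : M ↦ (inner ℝ (coordField (M := M) p (fun _ ↦ a) z)
      (coordField (M := M) p (fun _ ↦ b) z) : ℝ)) x :=
  ContMDiffAt.inner_bundle (contMDiffAt_coordField hx contDiffAt_const)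
    (contMDiffAt_coordField hx contDiffAt_const)

variable [FiniteDimensional ℝ E]
  {cov : CovariantDerivative 𝓘(ℝ, E) E (TangentSpace 𝓘(ℝ, E) : M → Type _)}

lemma christoffel_symm (htors : cov.torsion = 0) {y : E}
    (hy : y ∈ (extChartAt 𝓘(ℝ, E) p).target) (a b : E) :
    christoffel cov p y a b = christoffel cov p y b a := by
  have := FiniteDimensional.complete ℝ E
  obtain ⟨x, hx, rfl⟩ : ∃ x ∈ (chartAt E p).source, extChartAt 𝓘(ℝ, E) p x = y :=
    ⟨_, extChartAt_symm_mem hy, (extChartAt 𝓘(ℝ, E) p).right_inv hy⟩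
  have hs (w : E) : CMDiffAt ∞ (T% (coordField (M := M) p fun _ ↦ w)) x :=
    contMDiffAt_coordField hx contDiffAt_const
  have hf (w : E) : fderiv ℝ (coordRep (M := M) p (coordField p fun _ ↦ w))
      (extChartAt 𝓘(ℝ, E) p x) = 0 := by
    have : coordRep (M := M) p (coordField p fun _ ↦ w)
        =ᶠ[𝓝 (extChartAt 𝓘(ℝ, E) p x)] fun _ ↦ w := by
      filter_upwards [(isOpen_extChartAt_target p).mem_nhds (extChartAt_mem_target hx)] with y hy
        using coordRep_coordField hy _
    rw [this.fderiv_eq, fderiv_fun_const]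
    rfl
  have h := congrArg (toCoord p x) (torsion_eq_zero_apply htors (hs b) (hs a))
  rw [map_sub, map_sub, map_zero, toCoord_mlieBracket hx (hs b) (hs a), hf, hf] at h
  simp only [_root_.zero_apply, sub_zero, sub_eq_zero] at h
  rw [christoffel_apply hx, christoffel_apply hx]
  exact h

variable [RiemannianBundle (fun x : M ↦ TangentSpace 𝓘(ℝ, E) x)]

/-- The coordinate expression of the Riemannian metric in the chart at `p`. -/
noncomputable def metricRep (p : M) (y : E) : E →L[ℝ] E →L[ℝ] ℝ :=
  LinearMap.toContinuousLinearMap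
    { toFun := fun a ↦ (innerSL ℝ (ofCoord p ((extChartAt 𝓘(ℝ, E) p).symm y) a)).comp
        (ofCoord p ((extChartAt 𝓘(ℝ, E) p).symm y))
      map_add' := fun a b ↦ by
        ext u
        simp only [map_add, ContinuousLinearMap.comp_apply, _root_.add_apply]
      map_smul' := fun c a ↦ by
        ext u
        simp only [map_smul, ContinuousLinearMap.comp_apply, _root_.smul_apply, RingHom.id_apply] }

lemma metricRep_apply (p : M) (y a b : E) : metricRep p y a b =
    inner ℝ (ofCoord p ((extChartAt 𝓘(ℝ, E) p).symm y) a)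
      (ofCoord p ((extChartAt 𝓘(ℝ, E) p).symm y) b) := rfl

lemma metricRep_apply_eq_comp (p : M) (a b : E) : (fun y ↦ metricRep p y a b) =
    (fun z : M ↦ (inner ℝ (coordField (M := M) p (fun _ ↦ a) z)
      (coordField (M := M) p (fun _ ↦ b) z) : ℝ)) ∘ (extChartAt 𝓘(ℝ, E) p).symm := rfl

lemma metricRep_symm (p : M) (y a b : E) : metricRep p y a b = metricRep p y b a := by
  rw [metricRep_apply, metricRep_apply, real_inner_comm]

lemma metricRep_pos {y : E} (hy : y ∈ (extChartAt 𝓘(ℝ, E) p).target) {a : E} (ha : a ≠ 0) :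
    0 < metricRep p y a a := by
  rw [metricRep_apply]
  refine real_inner_self_pos.2 fun h ↦ ha ?_
  rw [← toCoord_ofCoord (extChartAt_symm_mem hy) a, h, map_zero]

variable [IsContMDiffRiemannianBundle 𝓘(ℝ, E) ∞ E (fun x : M ↦ TangentSpace 𝓘(ℝ, E) x)]

lemma contDiffOn_metricRep :
    ContDiffOn ℝ ∞ (metricRep (M := M) p) (extChartAt 𝓘(ℝ, E) p).target := by
  rw [contDiffOn_bilin_iff]
  intro a b y hy
  obtain ⟨x, hx, rfl⟩ : ∃ x ∈ (chartAt E p).source, extChartAt 𝓘(ℝ, E) p x = y :=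
    ⟨_, extChartAt_symm_mem hy, (extChartAt 𝓘(ℝ, E) p).right_inv hy⟩
  exact ((contMDiffAt_iff_contDiffAt_comp_symm hx).1
    (contMDiffAt_inner_coordField hx a b)).contDiffWithinAt

lemma fderiv_metricRep {y : E} (hy : y ∈ (extChartAt 𝓘(ℝ, E) p).target) (u a b : E) :
    fderiv ℝ (metricRep p) y u a b = metricRep p y (christoffel cov p y a u) b +
      metricRep p y a (christoffel (dual cov) p y b u) := by
  have hd := (contDiffOn_metricRep.contDiffAt
    ((isOpen_extChartAt_target p).mem_nhds hy)).differentiableAt (by simp)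
  rw [← fderiv_bilin_apply_const hd]
  obtain ⟨x, hx, rfl⟩ : ∃ x ∈ (chartAt E p).source, extChartAt 𝓘(ℝ, E) p x = y :=
    ⟨_, extChartAt_symm_mem hy, (extChartAt 𝓘(ℝ, E) p).right_inv hy⟩
  have hs (w : E) : MDiffAt (T% (coordField (M := M) p fun _ ↦ w)) x :=
    (contMDiffAt_coordField hx contDiffAt_const).mdifferentiableAt (by simp)
  have h1 := dual_spec cov (hs a) (hs b) (ofCoord p x u)
  have h2 := mvfderiv_eq_fderiv hx
    ((contMDiffAt_inner_coordField hx a b).mdifferentiableAt (by simp)) (ofCoord p x u)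
  rw [toCoord_ofCoord hx] at h2
  rw [metricRep_apply_eq_comp, ← h2, h1, christoffel_apply hx,
    christoffel_apply hx, metricRep_apply, metricRep_apply, extChartAt_symm_apply hx,
    ofCoord_toCoord hx, ofCoord_toCoord hx]
  rfl

/-- The two connections differ by the cubic form with its last index raised, which is symmetric in
the other two arguments. This is where the symmetry of the cubic form is used. -/
lemma torsion_dual (h : IsStatistical cov) : (dual cov).torsion = 0 := by
  have := FiniteDimensional.complete ℝ E
  rw [CovariantDerivative.torsion_eq_zero_iff]
  intro X Y x hX hY
  rw [← (CovariantDerivative.torsion_eq_zero_iff cov).1 h.torsion_eq_zero hX hY]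
  have hd (Z : Π x : M, TangentSpace 𝓘(ℝ, E) x) (v : TangentSpace 𝓘(ℝ, E) x) :
      dual cov Z x v = cov Z x v + sharp x (cubicFormLast cov x v (Z x)) := rfl
  have hc : cubicFormLast cov x (X x) (Y x) = cubicFormLast cov x (Y x) (X x) := by
    ext w
    exact (h.cubicForm_symm x (X x) (Y x) w).1
  rw [hd, hd, hc]
  abel

/-- The duality relation expresses the dual symbols, with an index lowered, through g, its
derivative and Γ; nondegeneracy of g raises the index again, so the smoothness of `sharp` need not
be examined. -/
lemma contDiffOn_christoffel_dual (hΓ : ContDiffOn ℝ ∞ (christoffel cov p)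
    (extChartAt 𝓘(ℝ, E) p).target) :
    ContDiffOn ℝ ∞ (christoffel (dual cov) p) (extChartAt 𝓘(ℝ, E) p).target := by
  rw [contDiffOn_bilin_iff] at hΓ ⊢
  have hg : ContDiffOn ℝ ∞ (metricRep (M := M) p) (extChartAt 𝓘(ℝ, E) p).target :=
    contDiffOn_metricRep
  intro b u
  refine contDiffOn_of_contDiffOn_metric_apply hg (fun y hy a ha ↦ metricRep_pos hy ha) fun a ↦ ?_
  have h1 : ContDiffOn ℝ ∞ (fun y ↦ fderiv ℝ (metricRep p) y u a b -
      metricRep p y (christoffel cov p y a u) b) (extChartAt 𝓘(ℝ, E) p).target :=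
    ((((hg.fderiv_of_isOpen (isOpen_extChartAt_target p) (m := ∞) le_rfl).clm_apply
      contDiffOn_const).clm_apply contDiffOn_const).clm_apply contDiffOn_const).sub
      ((hg.clm_apply (hΓ a u)).clm_apply contDiffOn_const)
  refine h1.congr fun y hy ↦ ?_
  rw [fderiv_metricRep (cov := cov) hy, add_sub_cancel_left, metricRep_symm]

theorem isConjugatePairOn_christoffel [T2Space M] (h : IsStatistical cov)
    (hconj : IsConjugateSymmetric cov) (p : M) :
    IsConjugatePairOn (metricRep p) (christoffel cov p) (christoffel (dual cov) p)
      (extChartAt 𝓘(ℝ, E) p).target where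
  contDiffOn_metric := contDiffOn_metricRep
  contDiffOn := contDiffOn_christoffel h.smooth
  contDiffOn' := contDiffOn_christoffel_dual (contDiffOn_christoffel h.smooth)
  metric_symm y _ a b := metricRep_symm p y a b
  metric_pos y hy a ha := metricRep_pos hy ha
  symm y hy := christoffel_symm h.torsion_eq_zero hy
  symm' y hy := christoffel_symm (torsion_dual h) hy
  compat y hy := fderiv_metricRep hy
  curvature_eq y hy u v w := by
    have hy' := (isOpen_extChartAt_target p).mem_nhds hy
    have hΓ := (contDiffOn_christoffel (p := p) h.smooth).contDiffAt hy'
    have hΓ' := (contDiffOn_christoffel_dual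
      (contDiffOn_christoffel (p := p) h.smooth)).contDiffAt hy'
    obtain ⟨x, hx, rfl⟩ : ∃ x ∈ (chartAt E p).source, extChartAt 𝓘(ℝ, E) p x = y :=
      ⟨_, extChartAt_symm_mem hy, (extChartAt 𝓘(ℝ, E) p).right_inv hy⟩
    -- Conjugate symmetry speaks of global fields, so the three coordinate vectors are realized as
    -- values of such fields.
    obtain ⟨X, hX, rfl⟩ := exists_contMDiff_toCoord_eq hx u
    obtain ⟨Y, hY, rfl⟩ := exists_contMDiff_toCoord_eq hx v
    obtain ⟨Z, hZ, rfl⟩ := exists_contMDiff_toCoord_eq hx w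
    rw [← toCoord_curvature hx hΓ hX.contMDiffAt hY.contMDiffAt hZ.contMDiffAt,
      ← toCoord_curvature hx hΓ' hX.contMDiffAt hY.contMDiffAt hZ.contMDiffAt,
      hconj X Y Z hX hY hZ x]

theorem isProjectivelyFlat_iff_dual [T2Space M] (h : IsStatistical cov)
    (hconj : IsConjugateSymmetric cov) :
    IsProjectivelyFlat cov ↔ IsProjectivelyFlat (dual cov) := by
  have hp := isConjugatePairOn_christoffel h hconj
  rw [isProjectivelyFlat_iff h.torsion_eq_zero fun p ↦ (hp p).contDiffOn,
    isProjectivelyFlat_iff (torsion_dual h) fun p ↦ (hp p).contDiffOn']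
  refine forall_congr' fun p ↦ ⟨?_, ?_⟩
  · rintro ⟨W, hW, hpW, hWt, ρ, hρ, hR⟩
    obtain ⟨W', hW', hpW', hWW', ρ', hρ', hR'⟩ :=
      ((hp p).mono hWt).exists_projectively_flat_dual hW hρ hR hpW
    exact ⟨W', hW', hpW', hWW'.trans hWt, ρ', hρ', hR'⟩
  · rintro ⟨W, hW, hpW, hWt, ρ, hρ, hR⟩
    obtain ⟨W', hW', hpW', hWW', ρ', hρ', hR'⟩ :=
      (((hp p).mono hWt).swap hW).exists_projectively_flat_dual hW hρ hR hpW
    exact ⟨W', hW', hpW', hWW'.trans hWt, ρ', hρ', hR'⟩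

end Dual

end StatGeom

theorem proposition2p2 (n : ℕ) {M : Type*} [TopologicalSpace M] [T2Space M]
    [SecondCountableTopology M] [ChartedSpace (EuclideanSpace ℝ (Fin n)) M] [IsManifold (𝓡 n) ∞ M]
    [RiemannianBundle (fun x : M ↦ TangentSpace (𝓡 n) x)]
    [IsContMDiffRiemannianBundle (𝓡 n) ∞ (EuclideanSpace ℝ (Fin n))
      (fun x : M ↦ TangentSpace (𝓡 n) x)]
    (cov : CovariantDerivative (𝓡 n) (EuclideanSpace ℝ (Fin n))
      (TangentSpace (𝓡 n) : M → Type _))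
    (hstat : StatGeom.IsStatistical cov) (hconj : StatGeom.IsConjugateSymmetric cov) :
    StatGeom.IsProjectivelyFlat cov ↔ StatGeom.IsProjectivelyFlat (StatGeom.dual cov) :=
  StatGeom.isProjectivelyFlat_iff_dual hstat hconj
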